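/- Let $-\infty<a<b<\infty$, $\Omega=(a,b)$, $\delta(x)=\operatorname{dist}(x,\partial\Omega)=\min(x-a,b-x)$, and let $m\in L^2(\Omega)$ be a real function, possibly sign-changing, that is not a.e. zero. Write $m=m^+-m^-$ with $m^+=\max(m,0)$, $m^-=\max(-m,0)$, and $m^-_a(x)=(x-a)m^-(x)$, $m^-_b(x)=(b-x)m^-(x)$. For $\gamma>0$ consider $$-u''=m(x)\,u^{-\gamma}\ \text{ in }\Omega,\qquad u>0\ \text{ in }\Omega,\qquad u(a)=u(b)=0. \tag{1}$$ A solution of (1) is a function $u\in W^{1,2}_{loc}(\Omega)\cap C([a,b])$ with $u>0$ in $\Omega$, $u(a)=u(b)=0$ and $\int_\Omega u'\varphi'=\int_\Omega m\,u^{-\gamma}\varphi$ for all $\varphi\in C_c^\infty(\Omega)$. Let $P^\circ$ be the interior, in $C^1_0([a,b])=\{w\in C^1([a,b]):w(a)=w(b)=0\}$ with the $C^1$ norm, of the cone of nonnegative functions. For $2\le p\le\infty$ let $p'$ be given by $1/p+1/p'=1$ ($p'=1$ if $p=\infty$). (i) Suppose that $m^-\in L^p(\Omega)$ with $2\le p\le\infty$,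 that $0<\gamma<1-\frac1p$ (that is, $\gamma<(p-1)/p$ if $p<\infty$, and $\gamma<1$ if $p=\infty$), and that $$\max\left(\|m^-_a\|_{L^p(\Omega)},\|m^-_b\|_{L^p(\Omega)}\right)\le c_{\gamma,p,a,b}\,\frac{\left(\int_a^b m^+\delta\,dt\right)^{1+\gamma}}{\left(\int_a^b m^+\,dt\right)^{\gamma}},\qquad c_{\gamma,p,a,b}=\frac{\gamma^\gamma}{(\gamma+1)^{\gamma+1}}\,\frac{(1-\gamma p')^{1/p'}}{(b-a)^{\gamma+1/p'}}$$ (the right-hand side being read as $0$ if $m^+=0$ a.e.). Then (1) has a solution $u\in C^1(\Omega)\cap C([a,b])$ with the following property: if $m^+\delta^{-\gamma}\in L^r(\Omega)$ for some $r>1$, then $u\in W^{2,q}(\Omega)\cap P^\circ$ for some $1<q<\infty$. (ii) If $$\max\left(\int_a^b m^-_a\,dt,\int_a^b m^-_b\,dt\right)<\int_a^b m^+\delta\,dt,$$ then there is $\gamma_0>0$ such that for every $\gamma\in(0,\gamma_0]$ problem (1) has a solution $u\in W^{2,q}(\Omega)\cap P^\circ$ for some $1<q<\infty$. (iii) If for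 some $\gamma>0$ problem (1) has a solution $u\in W^{2,q}(\Omega)$ for some $q>1$, then $$\int_a^b m^-\delta\,dt<\int_a^b m^+\delta\,dt.$$ -/

import Mathlib

open MeasureTheory Set
open scoped ENNReal ContDiff

noncomputable section

/-- Lebesgue measure on the interval `Ω = (a, b)`. -/
def volOn (a b : ℝ) : Measure ℝ := volume.restrict (Ioo a b)

/-- Distance to the boundary of `Ω = (a, b)`. -/
def bdryDist (a b x : ℝ) : ℝ := Metric.infDist x (frontier (Ioo a b))

/-- `h_a(x) = (x - a) h(x)`. -/
def leftWeight (a : ℝ) (h : ℝ → ℝ) (x : ℝ) : ℝ := (x - a) * h x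

/-- `h_b(x) = (b - x) h(x)`. -/
def rightWeight (b : ℝ) (h : ℝ → ℝ) (x : ℝ) : ℝ := (b - x) * h x

/-- The norm of `L^p(a, b)` as a real number (used only for functions of `L^p(a, b)`). -/
def lpNormOn (a b : ℝ) (p : ℝ≥0∞) (h : ℝ → ℝ) : ℝ := (eLpNorm h p (volOn a b)).toReal

/-- Test functions: the space `C_c^∞(a, b)`. -/
def IsTestFun (a b : ℝ) (φ : ℝ → ℝ) : Prop :=
  ContDiff ℝ ∞ φ ∧ HasCompactSupport φ ∧ tsupport φ ⊆ Ioo a b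

/-- `g` is the weak (distributional) derivative of `f` on `(a, b)`. -/
def HasWeakDerivOn (a b : ℝ) (f g : ℝ → ℝ) : Prop :=
  LocallyIntegrableOn f (Ioo a b) ∧ LocallyIntegrableOn g (Ioo a b) ∧
    ∀ φ : ℝ → ℝ, IsTestFun a b φ →
      ∫ x in Ioo a b, f x * deriv φ x = - ∫ x in Ioo a b, g x * φ x

/-- The Sobolev space `W^{2,q}(a, b)`. -/
def MemW2 (a b : ℝ) (q : ℝ≥0∞) (u : ℝ → ℝ) : Prop :=
  MemLp u q (volOn a b) ∧
    ∃ u₁ u₂ : ℝ → ℝ, HasWeakDerivOn a b u u₁ ∧ HasWeakDerivOn a b u₁ u₂ ∧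
      MemLp u₁ q (volOn a b) ∧ MemLp u₂ q (volOn a b)

/-- `u ∈ W^{1,2}_loc(a, b) ∩ C([a, b])` is a solution, in the sense of distributions, of
`-u'' = m(x) u^{-γ}` and `u > 0` in `(a, b)`, `u = 0` at `a` and `b`. -/
def IsSingularSolution (a b : ℝ) (m : ℝ → ℝ) (γ : ℝ) (u : ℝ → ℝ) : Prop :=
  ContinuousOn u (Icc a b) ∧ (∀ x ∈ Ioo a b, 0 < u x) ∧ u a = 0 ∧ u b = 0 ∧
    ∃ u₁ : ℝ → ℝ, HasWeakDerivOn a b u u₁ ∧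
      (∀ C : Set ℝ, IsCompact C → C ⊆ Ioo a b → MemLp u₁ 2 (volume.restrict C)) ∧
      ∀ φ : ℝ → ℝ, IsTestFun a b φ →
        ∫ x in Ioo a b, u₁ x * deriv φ x = ∫ x in Ioo a b, m x * u x ^ (-γ) * φ x

/-- The space `C^1_0([a, b])` of the functions of class `C^1` up to the boundary that vanish
at `a` and `b`. -/
def MemC10 (a b : ℝ) (w : ℝ → ℝ) : Prop :=
  ContDiffOn ℝ 1 w (Icc a b) ∧ w a = 0 ∧ w b = 0

/-- `P°`, the interior, for the `C^1` norm, of the cone of nonnegative functions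
of `C^1_0([a, b])`. -/
def MemConeInterior (a b : ℝ) (u : ℝ → ℝ) : Prop :=
  MemC10 a b u ∧ ∃ ε > 0, ∀ w : ℝ → ℝ, MemC10 a b w →
    (∀ x ∈ Icc a b, |w x - u x| < ε ∧
      |derivWithin w (Icc a b) x - derivWithin u (Icc a b) x| < ε) →
    ∀ x ∈ Icc a b, 0 ≤ w x

/-- The constant
`c_{γ,p,a,b} = γ^γ / (γ+1)^{γ+1} * (1 - γ p')^{1/p'} / (b-a)^{γ + 1/p'}`,
where `p'` is the conjugate exponent of `p` (so `p' = 1` for `p = ∞`). -/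
def smallnessConst (γ : ℝ) (p : ℝ≥0∞) (a b : ℝ) : ℝ :=
  let p' : ℝ := (ENNReal.conjExponent p).toReal
  γ ^ γ / (γ + 1) ^ (γ + 1) * ((1 - γ * p') ^ (1 / p') / (b - a) ^ (γ + 1 / p'))

end

/-! Write f = m u^(-γ), δ for the distance to the boundary, and A = ∫ m⁺ δ. Two estimates carry the
proof.

The first tests -u'' = f against (t - c) u^γ on an interval (c, x₀) where u > 0 and u(c) = 0. The
factor u^γ removes the singularity, u' u^γ is the derivative of u^(1+γ)/(1+γ), and the remaining
term γ u'² u^(γ-1) (t - c) is nonnegative and is dropped. This bounds u(x₀)^(1+γ)/(1+γ), up to a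
boundary term in u'(x₀), by ∫ m (t - c) (`rpow_le_integral_left`, and `rpow_le_integral_right` by
reflection). Adding both sides at the midpoint cancels the boundary terms and gives ∫ m δ > 0, the
necessary condition. At an interior maximum u' = 0, which gives u ≤ S as soon as (1+γ) (b-a)/4 ∫ m⁺
≤ S^(1+γ) (`rpow_le_of_mul_rpow_le`).

The second uses Green's function G. One has G(x,t) ≥ δ(x) δ(t)/(b-a), while G(x,t) is at most δ(x)
(b-t)/(b-a) for x in the left half and δ(x) (t-a)/(b-a) for x in the right half. Hence, if kδ ≤ w ≤
S, the Green potential of m w^(-γ) is again at least kδ, provided that k(b-a) + k^(-γ) ∫ W δ^(-γ) ≤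
S^(-γ) A for both weights W = m⁻_a and W = m⁻_b (`mul_endDist_le_integral_green`).

For γ < 1 the problem with max(u, kδ)^(-γ) in place of u^(-γ) always has a solution
(`exists_truncated_solution`). The two estimates apply to it, so the truncation is inactive and the
singular problem is solved (`exists_green_solution`). Only k and S remain to be chosen. In (i)
Hölder's inequality bounds ∫ W δ^(-γ) and k is optimised, which accounts for the form of the
constant (`exists_barrier_parameters`, `smallnessConst_mul`). In (ii) k and S are fixed and γ → 0
turns the condition into k(b-a) + ∫ W < A. Regularity follows from u ≥ kδ, which bounds |u''| by a
multiple of |m| δ^(-γ). -/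

open Filter Topology

/-! ### Absolutely continuous primitives, test functions and weak derivatives -/

theorem integral_mul_deriv_of_primitive {v f g g' : ℝ → ℝ} {c d : ℝ} (hcd : c ≤ d)
    (hf : IntervalIntegrable f volume c d)
    (hv : ∀ x ∈ Icc c d, v x = v c + ∫ t in c..x, f t)
    (hg : ∀ x ∈ Icc c d, HasDerivAt g (g' x) x) (hg' : ContinuousOn g' (Icc c d)) :
    ∫ x in c..d, v x * g' x = v d * g d - v c * g c - ∫ x in c..d, f x * g x := by
  have hI : uIcc c d = Icc c d := uIcc_of_le hcd
  -- Since v is controlled only on [c, d], its pointwise derivatives are taken from this globally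
  -- defined primitive.
  set V : ℝ → ℝ := fun x => v c + ∫ t in c..x, f t with hV
  have hVac : AbsolutelyContinuousOnInterval V c d := by
    have h1 := hf.absolutelyContinuousOnInterval_intervalIntegral (c := c) left_mem_uIcc
    have h2 : AbsolutelyContinuousOnInterval (fun _ : ℝ => v c) c d :=
      LipschitzOnWith.absolutelyContinuousOnInterval (K := 0) (by simp [LipschitzOnWith])
    exact h2.add h1
  have hgac : AbsolutelyContinuousOnInterval g c d := by
    obtain ⟨C, hC⟩ := isCompact_Icc.exists_bound_of_continuousOn hg'
    have : LipschitzOnWith (Real.nnabs C) g (Icc c d) := by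
      refine (convex_Icc c d).lipschitzOnWith_of_nnnorm_hasDerivWithin_le
        (fun x hx => (hg x hx).hasDerivWithinAt) (fun x hx => ?_)
      rw [← NNReal.coe_le_coe]
      simpa using (hC x hx).trans (le_abs_self C)
    rw [← hI] at this
    exact this.absolutelyContinuousOnInterval
  have key := hVac.integral_mul_deriv_eq_deriv_mul hgac
  have e1 : ∫ x in c..d, V x * deriv g x = ∫ x in c..d, v x * g' x := by
    refine intervalIntegral.integral_congr fun x hx => ?_
    rw [hI] at hx
    simp only [hV, ← hv x hx, (hg x hx).deriv]
  have e2 : ∫ x in c..d, deriv V x * g x = ∫ x in c..d, f x * g x := by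
    refine intervalIntegral.integral_congr_ae ?_
    filter_upwards [hf.ae_hasDerivAt_integral] with x hx hxI
    have := ((hx (uIoc_subset_uIcc hxI)) c left_mem_uIcc).const_add (v c)
    rw [this.deriv]
  rw [e1, e2] at key
  rw [key, hv d (right_mem_Icc.2 hcd)]
  simp [hV]

/-- `v` is a primitive of `f` in the open interval `(a, b)`. -/
def IsPrimitiveOn (a b : ℝ) (v f : ℝ → ℝ) : Prop :=
  ∀ x ∈ Ioo a b, ∀ y ∈ Ioo a b, v y - v x = ∫ t in x..y, f t

theorem MeasureTheory.LocallyIntegrableOn.intervalIntegrable_of_mem_Ioo {a b : ℝ} {f : ℝ → ℝ}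
    (hf : LocallyIntegrableOn f (Ioo a b)) {c d : ℝ} (hc : c ∈ Ioo a b) (hd : d ∈ Ioo a b) :
    IntervalIntegrable f volume c d := by
  have : uIcc c d ⊆ Ioo a b := ordConnected_Ioo.uIcc_subset hc hd
  exact (hf.integrableOn_compact_subset this isCompact_uIcc).intervalIntegrable

theorem IsPrimitiveOn.continuousOn {a b : ℝ} {v f : ℝ → ℝ} (h : IsPrimitiveOn a b v f)
    (hf : LocallyIntegrableOn f (Ioo a b)) : ContinuousOn v (Ioo a b) := by
  intro x hx
  obtain ⟨c, hac, hcx⟩ := exists_between hx.1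
  obtain ⟨d, hxd, hdb⟩ := exists_between hx.2
  have hc : c ∈ Ioo a b := ⟨hac, hcx.trans hx.2⟩
  have hd : d ∈ Ioo a b := ⟨hx.1.trans hxd, hdb⟩
  have h1 : ContinuousOn (fun y => v c + ∫ t in c..y, f t) (uIcc c d) :=
    continuousOn_const.add (intervalIntegral.continuousOn_primitive_interval
      (hf.integrableOn_compact_subset (ordConnected_Ioo.uIcc_subset hc hd) isCompact_uIcc))
  rw [uIcc_of_le (hcx.trans hxd).le] at h1
  have h2 : ContinuousOn v (Icc c d) := h1.congr fun y hy => by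
    have hy' : y ∈ Ioo a b := ⟨hac.trans_le hy.1, hy.2.trans_lt hdb⟩
    have := h c hc y hy'
    simp only; linarith
  exact (h2.continuousAt (Icc_mem_nhds hcx hxd)).continuousWithinAt

theorem IsPrimitiveOn.hasDerivAt {a b : ℝ} {u v : ℝ → ℝ} (h : IsPrimitiveOn a b u v)
    (hv : ContinuousOn v (Ioo a b)) {x : ℝ} (hx : x ∈ Ioo a b) : HasDerivAt u (v x) x := by
  have h1 : HasDerivAt (fun y => ∫ t in x..y, v t) (v x) x :=
    intervalIntegral.integral_hasDerivAt_right (by simp)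
      (hv.stronglyMeasurableAtFilter isOpen_Ioo x hx)
      (hv.continuousAt (isOpen_Ioo.mem_nhds hx))
  refine (h1.const_add (u x)).congr_of_eventuallyEq ?_
  filter_upwards [isOpen_Ioo.mem_nhds hx] with y hy
  have := h x hx y hy
  linarith

theorem exists_Icc_tsupport_subset {a b : ℝ} (hab : a < b) {φ : ℝ → ℝ} (hφ : IsTestFun a b φ) :
    ∃ c ∈ Ioo a b, ∃ d ∈ Ioo a b, c ≤ d ∧ tsupport φ ⊆ Ioo c d := by
  obtain ⟨-, hc, hs⟩ := hφ
  rcases (tsupport φ).eq_empty_or_nonempty with h | h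
  · have : (a + b) / 2 ∈ Ioo a b := ⟨by linarith, by linarith⟩
    exact ⟨_, this, _, this, le_rfl, by simp [h]⟩
  · obtain ⟨x, hx, hx'⟩ := hc.isCompact.exists_isLeast h
    obtain ⟨y, hy, hy'⟩ := hc.isCompact.exists_isGreatest h
    obtain ⟨c, h1, h2⟩ := exists_between (hs hx).1
    obtain ⟨d, h3, h4⟩ := exists_between (hs hy).2
    have hxy := hy' hx
    exact ⟨c, ⟨h1, h2.trans (hs hx).2⟩, d, ⟨(hs hy).1.trans h3, h4⟩, by linarith,
      fun t ht => ⟨h2.trans_le (hx' ht), (hy' ht).trans_lt h3⟩⟩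

theorem setIntegral_Ioo_eq_intervalIntegral {a b c d : ℝ} (hc : c ∈ Ioo a b) (hd : d ∈ Ioo a b)
    (hcd : c ≤ d) {F : ℝ → ℝ} (hF : ∀ x, x ∉ Ioo c d → F x = 0) :
    ∫ x in Ioo a b, F x = ∫ x in c..d, F x := by
  rw [intervalIntegral.integral_of_le hcd, integral_Ioc_eq_integral_Ioo]
  have hs : Ioo c d ⊆ Ioo a b := Ioo_subset_Ioo hc.1.le hd.2.le
  exact (setIntegral_eq_of_subset_of_forall_sdiff_eq_zero measurableSet_Ioo hs
    fun x hx => hF x hx.2)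

theorem IsPrimitiveOn.integral_mul_deriv_test {a b : ℝ} (hab : a < b) {v f φ : ℝ → ℝ}
    (h : IsPrimitiveOn a b v f) (hf : LocallyIntegrableOn f (Ioo a b)) (hφ : IsTestFun a b φ) :
    ∫ x in Ioo a b, v x * deriv φ x = - ∫ x in Ioo a b, f x * φ x := by
  obtain ⟨c, hc, d, hd, hcd, hs⟩ := exists_Icc_tsupport_subset hab hφ
  have hφ0 : ∀ x, x ∉ Ioo c d → φ x = 0 := fun x hx =>
    image_eq_zero_of_notMem_tsupport fun h' => hx (hs h')
  have hφ1 : ∀ x, x ∉ Ioo c d → deriv φ x = 0 := fun x hx =>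
    image_eq_zero_of_notMem_tsupport fun h' => hx (hs (tsupport_deriv_subset h'))
  have hd1 : Differentiable ℝ φ := hφ.1.differentiable (by simp)
  have hd2 : Continuous (deriv φ) := hφ.1.continuous_deriv (by simp)
  rw [setIntegral_Ioo_eq_intervalIntegral hc hd hcd fun x hx => by simp [hφ1 x hx],
    setIntegral_Ioo_eq_intervalIntegral hc hd hcd fun x hx => by simp [hφ0 x hx],
    integral_mul_deriv_of_primitive hcd (hf.intervalIntegrable_of_mem_Ioo hc hd)
      (fun x hx => ?_) (fun x _ => (hd1 x).hasDerivAt) hd2.continuousOn,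
    hφ0 c (by simp), hφ0 d (by simp)]
  · ring
  · have := h c hc x ⟨hc.1.trans_le hx.1, hx.2.trans_lt hd.2⟩
    linarith

theorem IsPrimitiveOn.hasWeakDerivOn {a b : ℝ} (hab : a < b) {v f : ℝ → ℝ}
    (h : IsPrimitiveOn a b v f) (hf : LocallyIntegrableOn f (Ioo a b)) :
    HasWeakDerivOn a b v f :=
  ⟨(h.continuousOn hf).locallyIntegrableOn measurableSet_Ioo, hf,
    fun _ hφ => h.integral_mul_deriv_test hab hf hφ⟩

theorem MeasureTheory.LocallyIntegrableOn.integrableOn_mul_continuous {a b : ℝ} (hab : a < b) {w φ : ℝ → ℝ}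
    (hw : LocallyIntegrableOn w (Ioo a b)) (hφ : IsTestFun a b φ) {ψ : ℝ → ℝ}
    (hψ : Continuous ψ) (hψφ : ∀ x, x ∉ tsupport φ → ψ x = 0) :
    IntegrableOn (fun x => w x * ψ x) (Ioo a b) := by
  obtain ⟨c, hc, d, hd, hcd, hs⟩ := exists_Icc_tsupport_subset hab hφ
  have h1 : IntegrableOn (fun x => w x * ψ x) (Icc c d) :=
    (hw.integrableOn_compact_subset (ordConnected_Ioo.out hc hd) isCompact_Icc).mul_continuousOn
      hψ.continuousOn isCompact_Icc
  refine (integrableOn_iff_integrable_of_support_subset ?_).1 h1 |>.integrableOn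
  intro x hx
  by_contra hx'
  exact hx (by simp [hψφ x fun h => hx' (Ioo_subset_Icc_self (hs h))])

theorem exists_testFun_integral_eq_one {a b : ℝ} (hab : a < b) :
    ∃ ρ, IsTestFun a b ρ ∧ ∫ x, ρ x = 1 := by
  let β : ContDiffBump ((a + b) / 2) := ⟨(b - a) / 8, (b - a) / 4, by linarith, by linarith⟩
  refine ⟨β.normed volume, ⟨β.contDiff_normed, β.hasCompactSupport_normed, ?_⟩,
    β.integral_normed⟩
  rw [β.tsupport_normed_eq, Real.closedBall_eq_Icc]
  intro x hx
  simp only [β, mem_Icc] at hx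
  constructor <;> linarith [hx.1, hx.2]

/-- Zero mean is what makes the primitive started left of the support vanish again to the right of
it. -/
theorem IsTestFun.exists_primitive {a b : ℝ} (hab : a < b) {ψ : ℝ → ℝ} (hψ : IsTestFun a b ψ)
    (h0 : ∫ x, ψ x = 0) : ∃ φ, IsTestFun a b φ ∧ deriv φ = ψ := by
  obtain ⟨c, hc, d, hd, hcd, hs⟩ := exists_Icc_tsupport_subset hab hψ
  have hψ0 : ∀ x, x ∉ Ioo c d → ψ x = 0 := fun x hx =>
    image_eq_zero_of_notMem_tsupport fun h' => hx (hs h')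
  have hψc : Continuous ψ := hψ.1.continuous
  let φ : ℝ → ℝ := fun x => ∫ t in c..x, ψ t
  have hder : ∀ x, HasDerivAt φ (ψ x) x := fun x =>
    intervalIntegral.integral_hasDerivAt_right (hψc.intervalIntegrable _ _)
      (hψc.stronglyMeasurableAtFilter _ _) hψc.continuousAt
  have hderiv : deriv φ = ψ := funext fun x => (hder x).deriv
  have hzero : ∀ x, x ∉ Icc c d → φ x = 0 := by
    intro x hx
    by_cases hxc : x < c
    · have : ∀ t ∈ uIcc c x, ψ t = 0 := fun t ht => hψ0 t fun h => by
        rw [uIcc_of_ge hxc.le] at ht; linarith [ht.2, h.1]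
      simp only [φ]
      rw [intervalIntegral.integral_congr (g := fun _ => (0 : ℝ)) this]; simp
    · have hxd : d ≤ x := by
        by_contra h; exact hx ⟨not_lt.1 hxc, (not_le.1 h).le⟩
      have : ∫ t in c..x, ψ t = ∫ t, ψ t :=
        intervalIntegral.integral_eq_integral_of_support_subset fun t ht => by
          by_contra h
          exact ht (hψ0 t fun h' => h ⟨h'.1, h'.2.le.trans hxd⟩)
      simp only [φ, this, h0]
  have hts : tsupport φ ⊆ Icc c d := by
    refine closure_minimal (fun x hx => ?_) isClosed_Icc
    by_contra h; exact hx (hzero x h)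
  have hts' : tsupport φ ⊆ Ioo a b := hts.trans (ordConnected_Ioo.out hc hd)
  refine ⟨φ, ⟨?_, ?_, hts'⟩, hderiv⟩
  · rw [contDiff_infty_iff_deriv, hderiv]
    exact ⟨fun x => (hder x).differentiableAt, hψ.1⟩
  · exact isCompact_Icc.of_isClosed_subset (isClosed_tsupport _) hts

/-- The lemma of du Bois-Reymond. -/
theorem ae_eq_const_of_integral_mul_deriv_eq_zero {a b : ℝ} (hab : a < b) {w : ℝ → ℝ}
    (hw : LocallyIntegrableOn w (Ioo a b))
    (h : ∀ φ, IsTestFun a b φ → ∫ x in Ioo a b, w x * deriv φ x = 0) :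
    ∃ C : ℝ, ∀ᵐ x, x ∈ Ioo a b → w x = C := by
  obtain ⟨ρ, hρ, hρ1⟩ := exists_testFun_integral_eq_one hab
  refine ⟨∫ x in Ioo a b, w x * ρ x, ?_⟩
  set C := ∫ x in Ioo a b, w x * ρ x with hC
  have hwC : LocallyIntegrableOn (fun x => w x - C) (Ioo a b) :=
    hw.sub ((locallyIntegrable_const C).locallyIntegrableOn _)
  have key := isOpen_Ioo.ae_eq_zero_of_integral_contDiff_smul_eq_zero hwC
    (fun ψ hψ1 hψ2 hψ3 => ?_)
  · filter_upwards [key] with x hx hxI using sub_eq_zero.1 (hx hxI)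
  have hψ : IsTestFun a b ψ := ⟨hψ1, hψ2, hψ3⟩
  set I := ∫ x, ψ x with hI
  have hψint : Integrable ψ := hψ1.continuous.integrable_of_hasCompactSupport hψ2
  have hρint : Integrable ρ := hρ.1.continuous.integrable_of_hasCompactSupport hρ.2.1
  -- Subtracting I ρ, where ρ has mass one, gives mean zero, so the difference is the derivative of
  -- an admissible test function.
  have hη : IsTestFun a b (fun x => ψ x - I * ρ x) := by
    have hts : tsupport (fun x => ψ x - I * ρ x) ⊆ tsupport ψ ∪ tsupport ρ := by
      refine closure_minimal (fun x hx => ?_) ((isClosed_tsupport _).union (isClosed_tsupport _))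
      by_contra h'
      rw [mem_union, not_or] at h'
      exact hx (by simp [image_eq_zero_of_notMem_tsupport h'.1,
        image_eq_zero_of_notMem_tsupport h'.2])
    exact ⟨hψ1.sub (contDiff_const.mul hρ.1),
      (hψ2.isCompact.union hρ.2.1.isCompact).of_isClosed_subset (isClosed_tsupport _) hts,
      hts.trans (union_subset hψ3 hρ.2.2)⟩
  obtain ⟨φ, hφ, hφ'⟩ := hη.exists_primitive hab (by
    rw [integral_sub hψint (hρint.const_mul I), integral_const_mul, hρ1]; simp [hI])
  have h1 := h φ hφ
  rw [hφ'] at h1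
  have i1 := hw.integrableOn_mul_continuous hab hψ hψ1.continuous
    fun x hx => image_eq_zero_of_notMem_tsupport hx
  have i2 := hw.integrableOn_mul_continuous hab hρ hρ.1.continuous
    fun x hx => image_eq_zero_of_notMem_tsupport hx
  have h2 : ∫ x in Ioo a b, w x * ψ x = I * C := by
    have : ∀ x, w x * (ψ x - I * ρ x) = w x * ψ x - I * (w x * ρ x) := fun x => by ring
    simp_rw [this] at h1
    rw [integral_sub i1 (i2.const_mul I), integral_const_mul] at h1
    linarith
  have h3 : ∫ x in Ioo a b, ψ x = I :=
    setIntegral_eq_integral_of_forall_compl_eq_zero fun x hx =>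
      image_eq_zero_of_notMem_tsupport fun h' => hx (hψ3 h')
  have h4 : ∫ x, ψ x • (w x - C) = ∫ x in Ioo a b, ψ x • (w x - C) :=
    (setIntegral_eq_integral_of_forall_compl_eq_zero fun x hx => by
      simp [image_eq_zero_of_notMem_tsupport fun h' => hx (hψ3 h')]).symm
  rw [h4]
  have : ∀ x, ψ x • (w x - C) = w x * ψ x - C * ψ x := fun x => by simp; ring
  simp_rw [this]
  rw [integral_sub i1 (hψint.integrableOn.const_mul C), integral_const_mul, h2, h3]
  ring

/-! ### Testing the equation against a power of the solution -/

theorem IsPrimitiveOn.hasDerivAt_of_isPrimitiveOn {a b : ℝ} {u v f : ℝ → ℝ}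
    (huv : IsPrimitiveOn a b u v) (hvf : IsPrimitiveOn a b v f)
    (hf : LocallyIntegrableOn f (Ioo a b)) {x : ℝ} (hx : x ∈ Ioo a b) : HasDerivAt u (v x) x :=
  huv.hasDerivAt (hvf.continuousOn hf) hx

/-- Integration by parts of v = u' against u^γ (t - c). The interval starts at c' ≥ c, where u is
still positive, so that every power of u is continuous; the limit c' → c is taken afterwards. -/
theorem rpow_sub_rpow_le_integral_on {a b c c' x₀ γ : ℝ} {u v f h : ℝ → ℝ}
    (hc' : c' ∈ Ioo a b) (hx₀ : x₀ ∈ Ioo a b) (hcc' : c ≤ c') (hcx : c' ≤ x₀)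
    (huv : IsPrimitiveOn a b u v) (hvf : IsPrimitiveOn a b v (-f))
    (hf : LocallyIntegrableOn f (Ioo a b)) (hγ : 0 < γ)
    (hpos : ∀ x ∈ Icc c' x₀, 0 < u x) (hfh : ∀ x ∈ Icc c' x₀, f x * u x ^ γ ≤ h x)
    (hh : IntervalIntegrable (fun t => h t * (t - c)) volume c' x₀) :
    v c' * (u c' ^ γ * (c' - c)) - v x₀ * (u x₀ ^ γ * (x₀ - c))
      + (u x₀ ^ (1 + γ) / (1 + γ) - u c' ^ (1 + γ) / (1 + γ)) ≤
      ∫ t in c'..x₀, h t * (t - c) := by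
  have hsub : Icc c' x₀ ⊆ Ioo a b := ordConnected_Ioo.out hc' hx₀
  have hvc : ContinuousOn v (Icc c' x₀) := (hvf.continuousOn hf.neg).mono hsub
  have hder : ∀ x ∈ Icc c' x₀, HasDerivAt u (v x) x := fun x hx =>
    huv.hasDerivAt_of_isPrimitiveOn hvf hf.neg (hsub hx)
  have huc : ContinuousOn u (Icc c' x₀) := fun x hx =>
    (hder x hx).continuousAt.continuousWithinAt
  have hpc : ∀ r : ℝ, ContinuousOn (fun x => u x ^ r) (Icc c' x₀) := fun r =>
    huc.rpow_const fun x hx => Or.inl (hpos x hx).ne'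
  have hgd : ∀ x ∈ Icc c' x₀, HasDerivAt (fun t => u t ^ γ * (t - c))
      (v x * γ * u x ^ (γ - 1) * (x - c) + u x ^ γ * 1) x := fun x hx =>
    ((hder x hx).rpow_const (Or.inl (hpos x hx).ne')).mul ((hasDerivAt_id x).sub_const c)
  have hlin : ContinuousOn (fun x : ℝ => x - c) (Icc c' x₀) := by fun_prop
  have hg'c : ContinuousOn (fun x => v x * γ * u x ^ (γ - 1) * (x - c) + u x ^ γ * 1)
      (Icc c' x₀) :=
    (((hvc.mul continuousOn_const).mul (hpc _)).mul hlin).add ((hpc _).mul continuousOn_const)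
  have hfi := hf.intervalIntegrable_of_mem_Ioo hc' hx₀
  have key := integral_mul_deriv_of_primitive (v := v) hcx hfi.neg
    (fun x hx => by have := hvf c' hc' x (hsub hx); linarith) hgd hg'c
  have hzd : ∀ x ∈ uIcc c' x₀, HasDerivAt (fun t => u t ^ (1 + γ) / (1 + γ))
      (v x * u x ^ γ) x := fun x hx => by
    rw [uIcc_of_le hcx] at hx
    have := ((hder x hx).rpow_const (p := 1 + γ) (Or.inl (hpos x hx).ne')).div_const (1 + γ)
    refine this.congr_deriv ?_
    rw [add_sub_cancel_left]
    field_simp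
  have hvi : IntervalIntegrable (fun x => v x * u x ^ γ) volume c' x₀ := by
    refine ContinuousOn.intervalIntegrable ?_
    rw [uIcc_of_le hcx]
    exact hvc.mul (hpc _)
  have hz := intervalIntegral.integral_eq_sub_of_hasDerivAt hzd hvi
  -- The difference of the two integrands is γ v² u^(γ-1) (x - c), which is nonnegative and possibly
  -- not integrable up to c; this is why it is discarded before the limit.
  have h1 : ∫ x in c'..x₀, v x * u x ^ γ ≤
      ∫ x in c'..x₀, v x * (v x * γ * u x ^ (γ - 1) * (x - c) + u x ^ γ * 1) := by
    refine intervalIntegral.integral_mono_on hcx hvi ?_ fun x hx => ?_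
    · refine ContinuousOn.intervalIntegrable ?_
      rw [uIcc_of_le hcx]
      exact hvc.mul hg'c
    · have h2 : 0 ≤ u x ^ (γ - 1) := (Real.rpow_pos_of_pos (hpos x hx) _).le
      have h3 : 0 ≤ x - c := by linarith [hx.1]
      have : 0 ≤ v x ^ 2 * γ * u x ^ (γ - 1) * (x - c) := by positivity
      nlinarith
  have hfgi : IntervalIntegrable (fun x => f x * (u x ^ γ * (x - c))) volume c' x₀ := by
    refine hfi.mul_continuousOn ?_
    rw [uIcc_of_le hcx]
    exact (hpc _).mul hlin
  have h4 : ∫ x in c'..x₀, f x * (u x ^ γ * (x - c)) ≤ ∫ x in c'..x₀, h x * (x - c) := by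
    refine intervalIntegral.integral_mono_on hcx hfgi hh fun x hx => ?_
    have h3 : 0 ≤ x - c := by linarith [hx.1]
    rw [← mul_assoc]
    exact mul_le_mul_of_nonneg_right (hfh x hx) h3
  have h5 : ∫ x in c'..x₀, (-f) x * (u x ^ γ * (x - c)) =
      - ∫ x in c'..x₀, f x * (u x ^ γ * (x - c)) := by
    rw [← intervalIntegral.integral_neg]
    simp
  simp only [Pi.neg_apply] at key h5
  rw [h5] at key
  linarith

/-- Testing `-u'' = f` on `(c, x₀)` against `(t - c) u ^ γ`, where `u c = 0`. -/
theorem rpow_le_integral_left {a b c x₀ γ : ℝ} {u v f h : ℝ → ℝ}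
    (hac : a ≤ c) (hcx : c < x₀) (hx₀ : x₀ < b) (hu : ContinuousOn u (Icc c x₀))
    (huv : IsPrimitiveOn a b u v) (hvf : IsPrimitiveOn a b v (-f))
    (hf : LocallyIntegrableOn f (Ioo a b)) (hγ : 0 < γ) (huc : u c = 0)
    (hpos : ∀ x ∈ Ioc c x₀, 0 < u x) (hfh : ∀ x ∈ Ioc c x₀, f x * u x ^ γ ≤ h x)
    (hh : IntervalIntegrable (fun t => h t * (t - c)) volume c x₀) :
    u x₀ ^ (1 + γ) / (1 + γ) - v x₀ * (u x₀ ^ γ * (x₀ - c)) ≤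
      ∫ t in c..x₀, h t * (t - c) := by
  have hxI : x₀ ∈ Ioo a b := ⟨hac.trans_lt hcx, hx₀⟩
  have hmem : ∀ x ∈ Ioc c x₀, x ∈ Ioo a b := fun x hx =>
    ⟨hac.trans_lt hx.1, hx.2.trans_lt hx₀⟩
  have hlim : Tendsto (fun y => (∫ t in y..x₀, h t * (t - c)) + u y ^ (1 + γ) / (1 + γ))
      (𝓝[>] c) (𝓝 ((∫ t in c..x₀, h t * (t - c)) + u c ^ (1 + γ) / (1 + γ))) := by
    have hle : 𝓝[>] c ≤ 𝓝[Icc c x₀] c := by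
      rw [← nhdsWithin_Ioc_eq_nhdsGT hcx]
      exact nhdsWithin_mono _ Ioc_subset_Icc_self
    refine Tendsto.add ?_ ?_
    · have h1 := intervalIntegral.continuousOn_primitive_interval_left (a := c) (b := x₀)
        (f := fun t => h t * (t - c)) (μ := volume) ?_
      · rw [uIcc_of_le hcx.le] at h1
        exact (h1 c (left_mem_Icc.2 hcx.le)).mono_left hle
      · rw [uIcc_of_le hcx.le, integrableOn_Icc_iff_integrableOn_Ioc]
        exact (intervalIntegrable_iff_integrableOn_Ioc_of_le hcx.le).1 hh
    · exact (((hu c (left_mem_Icc.2 hcx.le)).mono_left hle).rpow_const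
        (Or.inr (by linarith))).div_const _
  -- Nothing is known about the limit of u' at c. But u rises from 0, so by the mean value theorem
  -- u' > 0 at points arbitrarily close to c; along these the boundary term at y is nonnegative and
  -- can be dropped.
  have hfreq : ∃ᶠ y in 𝓝[>] c, y ∈ Ioo c x₀ ∧ 0 < v y := by
    intro hev
    obtain ⟨d, hd, hsub⟩ := (mem_nhdsGT_iff_exists_Ioo_subset).1 hev
    have hd' : c < min d x₀ := lt_min hd hcx
    obtain ⟨y, hy, hy'⟩ := exists_hasDerivAt_eq_slope u v hd'
      (hu.mono (Icc_subset_Icc_right (min_le_right _ _)))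
      (fun x hx => huv.hasDerivAt_of_isPrimitiveOn hvf hf.neg
        (hmem x ⟨hx.1, (hx.2.trans_le (min_le_right _ _)).le⟩))
    refine hsub ⟨hy.1, hy.2.trans_le (min_le_left _ _)⟩
      ⟨⟨hy.1, hy.2.trans_le (min_le_right _ _)⟩, ?_⟩
    rw [hy', huc, sub_zero]
    exact div_pos (hpos _ ⟨hd', min_le_right _ _⟩) (sub_pos.2 hd')
  have hge := ge_of_tendsto_of_frequently hlim (b := u x₀ ^ (1 + γ) / (1 + γ)
    - v x₀ * (u x₀ ^ γ * (x₀ - c))) (hfreq.mono fun y hy => ?_)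
  · rwa [huc, Real.zero_rpow (by linarith), zero_div, add_zero] at hge
  · obtain ⟨hyI, hvy⟩ := hy
    have hsub : Icc y x₀ ⊆ Ioc c x₀ := fun x hx => ⟨hyI.1.trans_le hx.1, hx.2⟩
    have := rpow_sub_rpow_le_integral_on (c := c) (hmem y ⟨hyI.1, hyI.2.le⟩) hxI hyI.1.le hyI.2.le
      huv hvf hf hγ (fun x hx => hpos x (hsub hx)) (fun x hx => hfh x (hsub hx))
      (hh.mono_set (by
        rw [uIcc_of_le hcx.le, uIcc_of_le hyI.2.le]
        exact Icc_subset_Icc_left hyI.1.le))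
    have h1 : 0 ≤ v y * (u y ^ γ * (y - c)) := by
      have := Real.rpow_pos_of_pos (hpos y ⟨hyI.1, hyI.2.le⟩) γ
      have h2 : 0 < y - c := sub_pos.2 hyI.1
      positivity
    linarith

theorem IsPrimitiveOn.comp_neg {a b : ℝ} {v f : ℝ → ℝ} (h : IsPrimitiveOn a b v f) :
    IsPrimitiveOn (-b) (-a) (fun x => v (-x)) (fun x => - f (-x)) := by
  intro x hx y hy
  have := h (-x) ⟨by linarith [hx.2], by linarith [hx.1]⟩ (-y)
    ⟨by linarith [hy.2], by linarith [hy.1]⟩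
  rw [this, intervalIntegral.integral_neg, intervalIntegral.integral_comp_neg,
    intervalIntegral.integral_symm]

theorem locallyIntegrableOn_comp_neg {a b : ℝ} {f : ℝ → ℝ}
    (hf : LocallyIntegrableOn f (Ioo a b)) :
    LocallyIntegrableOn (fun x => f (-x)) (Ioo (-b) (-a)) := by
  intro x hx
  have hx' : -x ∈ Ioo a b := ⟨by linarith [hx.2], by linarith [hx.1]⟩
  obtain ⟨c, hac, hcx⟩ := exists_between hx'.1
  obtain ⟨d, hxd, hdb⟩ := exists_between hx'.2
  have h1 := hf.intervalIntegrable_of_mem_Ioo (c := c) (d := d) ⟨hac, hcx.trans hx'.2⟩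
    ⟨hx'.1.trans hxd, hdb⟩
  have h2 := ((intervalIntegrable_iff_integrableOn_Ioo_of_le (by linarith)).1
    (h1.comp_sub_left 0).symm)
  exact ⟨Ioo (-d) (-c), mem_nhdsWithin_of_mem_nhds (Ioo_mem_nhds (by linarith) (by linarith)),
    by simpa using h2⟩

/-- Testing `-u'' = f` on `(x₀, d)` against `(d - t) u ^ γ`, where `u d = 0`. -/
theorem rpow_le_integral_right {a b d x₀ γ : ℝ} {u v f h : ℝ → ℝ}
    (hdb : d ≤ b) (hxd : x₀ < d) (hx₀ : a < x₀) (hu : ContinuousOn u (Icc x₀ d))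
    (huv : IsPrimitiveOn a b u v) (hvf : IsPrimitiveOn a b v (-f))
    (hf : LocallyIntegrableOn f (Ioo a b)) (hγ : 0 < γ) (hud : u d = 0)
    (hpos : ∀ x ∈ Ico x₀ d, 0 < u x) (hfh : ∀ x ∈ Ico x₀ d, f x * u x ^ γ ≤ h x)
    (hh : IntervalIntegrable (fun t => h t * (d - t)) volume x₀ d) :
    u x₀ ^ (1 + γ) / (1 + γ) + v x₀ * (u x₀ ^ γ * (d - x₀)) ≤
      ∫ t in x₀..d, h t * (d - t) := by
  have hI : ∀ x ∈ Ioc (-d) (-x₀), -x ∈ Ico x₀ d := fun x hx =>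
    ⟨by linarith [hx.2], by linarith [hx.1]⟩
  -- Reflection x ↦ -x; the derivative changes sign, hence the opposite sign of the term in v x₀.
  have key := rpow_le_integral_left (a := -b) (b := -a) (c := -d) (x₀ := -x₀) (γ := γ)
    (u := fun x => u (-x)) (v := fun x => - v (-x)) (f := fun x => f (-x))
    (h := fun x => h (-x)) (by linarith) (by linarith) (by linarith)
    (hu.comp continuous_neg.continuousOn fun x hx =>
      ⟨by linarith [hx.2], by linarith [hx.1]⟩)
    huv.comp_neg (by
      intro x hx y hy
      have h1 := hvf.comp_neg x hx y hy
      simp only [Pi.neg_apply, neg_neg] at h1 ⊢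
      rw [intervalIntegral.integral_neg, ← h1]
      ring)
    (locallyIntegrableOn_comp_neg hf) hγ (by simpa using hud) (fun x hx => hpos _ (hI x hx))
    (fun x hx => hfh _ (hI x hx)) ?_
  · have e : ∫ t in (-d)..(-x₀), h (-t) * (t - -d) = ∫ t in x₀..d, h t * (d - t) := by
      rw [← intervalIntegral.integral_comp_neg]
      refine intervalIntegral.integral_congr fun t _ => ?_
      rw [neg_neg]
      ring
    rw [e] at key
    simp only [neg_neg] at key
    linarith
  · have := (hh.comp_sub_left 0).symm
    simp only [zero_sub] at this
    refine this.congr fun t _ => ?_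
    change h (-t) * (d - -t) = h (-t) * (t - -d)
    ring

/-! ### From weak to strong solutions, and the necessary condition -/

theorem bdryDist_eq_min {a b x : ℝ} (hab : a < b) (hx : x ∈ Icc a b) :
    bdryDist a b x = min (x - a) (b - x) := by
  rw [bdryDist, frontier_Ioo hab, Metric.infDist_eq_iInf]
  refine le_antisymm (le_min ?_ ?_) ?_
  · refine (ciInf_le ⟨0, by rintro _ ⟨y, rfl⟩; exact dist_nonneg⟩
      (⟨a, by simp⟩ : ({a, b} : Set ℝ))).trans ?_
    rw [Real.dist_eq, abs_of_nonneg (by linarith [hx.1])]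
  · refine (ciInf_le ⟨0, by rintro _ ⟨y, rfl⟩; exact dist_nonneg⟩
      (⟨b, by simp⟩ : ({a, b} : Set ℝ))).trans ?_
    rw [Real.dist_eq, abs_of_nonpos (by linarith [hx.2])]
    simp
  · have : Nonempty ({a, b} : Set ℝ) := ⟨⟨a, by simp⟩⟩
    refine le_ciInf ?_
    rintro ⟨y, rfl | rfl⟩
    · rw [Real.dist_eq, abs_of_nonneg (by linarith [hx.1])]
      exact min_le_left _ _
    · rw [Real.dist_eq, abs_of_nonpos (by linarith [hx.2])]
      simp

theorem locallyIntegrableOn_mul_of_continuousOn {a b : ℝ} {f g : ℝ → ℝ}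
    (hf : LocallyIntegrableOn f (Ioo a b)) (hg : ContinuousOn g (Ioo a b)) :
    LocallyIntegrableOn (fun x => f x * g x) (Ioo a b) := by
  rw [locallyIntegrableOn_iff isOpen_Ioo.isLocallyClosed] at hf ⊢
  exact fun K hK hKc => (hf K hK hKc).mul_continuousOn (hg.mono hK) hKc

theorem isPrimitiveOn_integral {a b x₀ : ℝ} (hx₀ : x₀ ∈ Ioo a b) {f : ℝ → ℝ}
    (hf : LocallyIntegrableOn f (Ioo a b)) :
    IsPrimitiveOn a b (fun x => ∫ t in x₀..x, f t) f := fun _ hx _ hy =>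
  intervalIntegral.integral_interval_sub_left (hf.intervalIntegrable_of_mem_Ioo hx₀ hy)
    (hf.intervalIntegrable_of_mem_Ioo hx₀ hx)

/-- A continuous weak solution of `-u'' = f` has an absolutely continuous derivative. -/
theorem exists_isPrimitiveOn_of_weak {a b : ℝ} (hab : a < b) {u u₁ f : ℝ → ℝ}
    (huc : ContinuousOn u (Ioo a b)) (hu : HasWeakDerivOn a b u u₁)
    (hf : LocallyIntegrableOn f (Ioo a b))
    (h : ∀ φ, IsTestFun a b φ → ∫ x in Ioo a b, u₁ x * deriv φ x = ∫ x in Ioo a b, f x * φ x) :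
    ∃ v, IsPrimitiveOn a b u v ∧ IsPrimitiveOn a b v (-f) := by
  obtain ⟨-, hu₁, hweak⟩ := hu
  have hx₀ : (a + b) / 2 ∈ Ioo a b := ⟨by linarith, by linarith⟩
  have hF := isPrimitiveOn_integral hx₀ hf
  set F : ℝ → ℝ := fun x => ∫ t in ((a + b) / 2)..x, f t
  have hFl : LocallyIntegrableOn F (Ioo a b) :=
    (hF.continuousOn hf).locallyIntegrableOn measurableSet_Ioo
  have htd : ∀ φ, IsTestFun a b φ → Continuous (deriv φ) ∧
      ∀ x, x ∉ tsupport φ → deriv φ x = 0 := fun φ hφ =>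
    ⟨hφ.1.continuous_deriv (by simp), fun x hx =>
      image_eq_zero_of_notMem_tsupport fun h' => hx (tsupport_deriv_subset h')⟩
  have hint : ∀ {w : ℝ → ℝ}, LocallyIntegrableOn w (Ioo a b) → ∀ φ, IsTestFun a b φ →
      IntegrableOn (fun x => w x * deriv φ x) (Ioo a b) := fun hw φ hφ =>
    hw.integrableOn_mul_continuous hab hφ (htd φ hφ).1 (htd φ hφ).2
  -- The equation says that u₁ + F has zero weak derivative, so u₁ = C - F a.e., which is the
  -- continuous representative v. A second application, to u minus a primitive of v, identifies u
  -- itself.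
  obtain ⟨C, hC⟩ := ae_eq_const_of_integral_mul_deriv_eq_zero hab (hu₁.add hFl) (fun φ hφ => by
    simp only [Pi.add_apply, add_mul]
    rw [integral_add (hint hu₁ φ hφ) (hint hFl φ hφ), h φ hφ,
      hF.integral_mul_deriv_test hab hf hφ]
    ring)
  have hv : IsPrimitiveOn a b (fun x => C - F x) (-f) := fun x hx y hy => by
    have := hF x hx y hy
    simp only [Pi.neg_apply, intervalIntegral.integral_neg]
    linarith
  have hvc := hv.continuousOn hf.neg
  set v : ℝ → ℝ := fun x => C - F x with hvdef
  have hvl := hvc.locallyIntegrableOn measurableSet_Ioo (μ := volume)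
  refine ⟨v, ?_, hv⟩
  have hV := isPrimitiveOn_integral hx₀ hvl
  set V : ℝ → ℝ := fun x => ∫ t in ((a + b) / 2)..x, v t
  have hVc := hV.continuousOn hvl
  have hul := huc.locallyIntegrableOn measurableSet_Ioo (μ := volume)
  have hVl := hVc.locallyIntegrableOn measurableSet_Ioo (μ := volume)
  obtain ⟨C', hC'⟩ := ae_eq_const_of_integral_mul_deriv_eq_zero hab (hul.sub hVl)
    (fun φ hφ => by
      simp only [Pi.sub_apply, sub_mul]
      rw [integral_sub (hint hul φ hφ) (hint hVl φ hφ), hweak φ hφ,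
        hV.integral_mul_deriv_test hab hvl hφ]
      have : ∫ x in Ioo a b, u₁ x * φ x = ∫ x in Ioo a b, v x * φ x := by
        refine setIntegral_congr_ae measurableSet_Ioo ?_
        filter_upwards [hC] with x hx hxI
        have := hx hxI
        simp only [Pi.add_apply] at this
        rw [hvdef]
        simp only
        rw [← this]; ring
      rw [this]; ring)
  have heq : EqOn (u - V) (fun _ => C') (Ioo a b) :=
    Measure.eqOn_open_of_ae_eq (μ := volume)
      ((ae_restrict_iff' measurableSet_Ioo).2 hC') isOpen_Ioo (huc.sub hVc) continuousOn_const
  intro x hx y hy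
  have h1 := heq hx
  have h2 := heq hy
  simp only [Pi.sub_apply] at h1 h2
  rw [← hV x hx y hy]
  linarith

theorem integral_mul_bdryDist {a b : ℝ} (hab : a < b) {m : ℝ → ℝ}
    (hm : IntervalIntegrable m volume a b) :
    ∫ t in a..b, m t * bdryDist a b t =
      (∫ t in a..((a + b) / 2), m t * (t - a)) + ∫ t in ((a + b) / 2)..b, m t * (b - t) := by
  have h1 : a ≤ (a + b) / 2 := by linarith
  have h2 : (a + b) / 2 ≤ b := by linarith
  have hi : IntervalIntegrable (fun t => m t * bdryDist a b t) volume a b :=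
    hm.mul_continuousOn (Metric.continuous_infDist_pt _).continuousOn
  have hmem : (a + b) / 2 ∈ uIcc a b := by rw [uIcc_of_le hab.le]; exact ⟨h1, h2⟩
  rw [← intervalIntegral.integral_add_adjacent_intervals (b := (a + b) / 2)
    (hi.mono_set (uIcc_subset_uIcc_left hmem)) (hi.mono_set (uIcc_subset_uIcc_right hmem))]
  congr 1
  · refine intervalIntegral.integral_congr fun t ht => ?_
    rw [uIcc_of_le h1] at ht
    simp only [bdryDist_eq_min hab ⟨ht.1, ht.2.trans h2⟩]
    rw [min_eq_left (by linarith [ht.2])]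
  · refine intervalIntegral.integral_congr fun t ht => ?_
    rw [uIcc_of_le h2] at ht
    simp only [bdryDist_eq_min hab ⟨h1.trans ht.1, ht.2⟩]
    rw [min_eq_right (by linarith [ht.1])]

theorem intervalIntegrable_of_memLp_volOn {a b : ℝ} (hab : a < b) {m : ℝ → ℝ} {p : ℝ≥0∞}
    (hp : 1 ≤ p) (hm : MemLp m p (volOn a b)) : IntervalIntegrable m volume a b := by
  have : IsFiniteMeasure (volOn a b) := ⟨by simp [volOn]⟩
  exact (intervalIntegrable_iff_integrableOn_Ioo_of_le hab.le).2 (hm.integrable hp)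

/-- A solution forces the weighted integral of the positive part of the weight to exceed that
of the negative part. -/
theorem IsSingularSolution.integral_negPart_lt {a b : ℝ} (hab : a < b) {m : ℝ → ℝ}
    (hm : MemLp m 2 (volOn a b)) {γ : ℝ} (hγ : 0 < γ) {u : ℝ → ℝ}
    (hu : IsSingularSolution a b m γ u) :
    ∫ t in a..b, m⁻ t * bdryDist a b t < ∫ t in a..b, m⁺ t * bdryDist a b t := by
  obtain ⟨huc, hpos, hua, hub, u₁, hwk, -, hsol⟩ := hu
  have hmi : IntervalIntegrable m volume a b :=
    intervalIntegrable_of_memLp_volOn hab (by norm_num) hm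
  have hmp : IntervalIntegrable m⁺ volume a b :=
    intervalIntegrable_of_memLp_volOn hab (by norm_num) hm.pos_part
  have hmn : IntervalIntegrable m⁻ volume a b :=
    intervalIntegrable_of_memLp_volOn hab (by norm_num) hm.neg_part
  have hml : LocallyIntegrableOn m (Ioo a b) :=
    ((intervalIntegrable_iff_integrableOn_Ioo_of_le hab.le).1 hmi).locallyIntegrableOn
  have huo := huc.mono Ioo_subset_Icc_self
  have hfl : LocallyIntegrableOn (fun x => m x * u x ^ (-γ)) (Ioo a b) :=
    locallyIntegrableOn_mul_of_continuousOn hml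
      (huo.rpow_const fun x hx => Or.inl (hpos x hx).ne')
  obtain ⟨v, huv, hvf⟩ := exists_isPrimitiveOn_of_weak hab huo hwk hfl hsol
  -- On the two halves δ is exactly t - a and b - t, the weights of the two one-sided inequalities.
  set c := (a + b) / 2 with hc
  have h1 : a < c := by rw [hc]; linarith
  have h2 : c < b := by rw [hc]; linarith
  have hle : ∀ x ∈ Ioo a b, m x * u x ^ (-γ) * u x ^ γ ≤ m x := fun x hx => by
    rw [mul_assoc, ← Real.rpow_add (hpos x hx)]; simp
  have hcm : c ∈ uIcc a b := by rw [uIcc_of_le hab.le]; exact ⟨h1.le, h2.le⟩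
  have hL := rpow_le_integral_left le_rfl h1 h2 (huc.mono (Icc_subset_Icc_right h2.le)) huv hvf
    hfl hγ hua (fun x hx => hpos x ⟨hx.1, hx.2.trans_lt h2⟩)
    (fun x hx => hle x ⟨hx.1, hx.2.trans_lt h2⟩)
    ((hmi.mono_set (uIcc_subset_uIcc_left hcm)).mul_continuousOn (by fun_prop))
  have hR := rpow_le_integral_right le_rfl h2 h1 (huc.mono (Icc_subset_Icc_left h1.le)) huv hvf
    hfl hγ hub (fun x hx => hpos x ⟨h1.trans_le hx.1, hx.2⟩)
    (fun x hx => hle x ⟨h1.trans_le hx.1, hx.2⟩)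
    ((hmi.mono_set (uIcc_subset_uIcc_right hcm)).mul_continuousOn (by fun_prop))
  have hδ : ContinuousOn (fun t => bdryDist a b t) (uIcc a b) :=
    (Metric.continuous_infDist_pt _).continuousOn
  have hkey := integral_mul_bdryDist hab hmi
  have hdiff : ∫ t in a..b, m t * bdryDist a b t =
      (∫ t in a..b, m⁺ t * bdryDist a b t) - ∫ t in a..b, m⁻ t * bdryDist a b t := by
    rw [← intervalIntegral.integral_sub (hmp.mul_continuousOn hδ) (hmn.mul_continuousOn hδ)]
    refine intervalIntegral.integral_congr fun t _ => ?_
    have : m t = m⁺ t - m⁻ t := by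
      conv_lhs => rw [← posPart_sub_negPart m]
      rfl
    rw [← sub_mul, ← this]
  have hp : 0 < u c ^ (1 + γ) / (1 + γ) :=
    div_pos (Real.rpow_pos_of_pos (hpos c ⟨h1, h2⟩) _) (by linarith)
  -- The terms in v c now have equal size and opposite signs; the sum of the two inequalities leaves
  -- 2 u(c)^(1+γ)/(1+γ) ≤ ∫ m δ.
  have e : b - c = c - a := by rw [hc]; ring
  rw [e] at hR
  rw [← hc] at hkey
  linarith

/-! ### Shooting for a bounded Lipschitz nonlinearity -/

/-- Green's function of `-u''` on `(a, b)` with Dirichlet conditions. -/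
noncomputable def green (a b x t : ℝ) : ℝ := (min x t - a) * (b - max x t) / (b - a)

instance isFiniteMeasure_volOn (a b : ℝ) : IsFiniteMeasure (volOn a b) := ⟨by simp [volOn]⟩

theorem ae_mem_volOn (a b : ℝ) : ∀ᵐ t ∂volOn a b, t ∈ Ioo a b :=
  ae_restrict_mem measurableSet_Ioo

/-- Splits Green's function into a part linear in x and the Volterra kernel (x - t)⁺. The linear
part is the initial slope selected by the condition at b, which links shooting with the Green
representation. -/
theorem green_eq_sub {a b : ℝ} (hab : a < b) (x t : ℝ) :
    green a b x t = (x - a) * (b - t) / (b - a) - max (x - t) 0 := by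
  have : b - a ≠ 0 := by linarith
  rw [green]
  rcases le_total x t with h | h
  · rw [min_eq_left h, max_eq_right h, max_eq_right (by linarith)]; ring
  · rw [min_eq_right h, max_eq_left h, max_eq_left (by linarith)]; field_simp; ring

/-- In the exponentially weighted unknown the Volterra kernel is of size 1/K, so the integral
operator contracts on the whole interval at once once K is large. -/
theorem max_sub_mul_exp_le {K : ℝ} (hK : 0 < K) (x t : ℝ) :
    max (x - t) 0 * Real.exp (-(K * (x - t))) ≤ 1 / K := by
  rcases le_total x t with h | h
  · rw [max_eq_right (by linarith), zero_mul]; positivity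
  · rw [max_eq_left (by linarith), Real.exp_neg, ← div_eq_mul_inv,
      div_le_div_iff₀ (Real.exp_pos _) hK]
    linarith [Real.add_one_le_exp (K * (x - t))]

section Volterra

variable {a b : ℝ} (hab : a < b) {m : ℝ → ℝ} {Φ : ℝ × ℝ → ℝ} (K s : ℝ)

/-- The nonlinear term along a trajectory written in exponentially weighted form. -/
noncomputable def weightedRhs (m : ℝ → ℝ) (Φ : ℝ × ℝ → ℝ) (w : C(Icc a b, ℝ)) (t : ℝ) : ℝ :=
  m t * Φ (t, Real.exp (K * (t - a)) * IccExtend hab.le w t)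

theorem integrable_weightedRhs (hm : Integrable m (volOn a b)) (hΦ : Continuous Φ) {C : ℝ}
    (hC : ∀ z, |Φ z| ≤ C) (w : C(Icc a b, ℝ)) :
    Integrable (weightedRhs hab K m Φ w) (volOn a b) := by
  refine hm.mul_bdd (c := C) ?_ ?_
  · have : Continuous fun t => Φ (t, Real.exp (K * (t - a)) * IccExtend hab.le w t) :=
      hΦ.comp (continuous_id.prodMk ((by fun_prop : Continuous fun t => Real.exp (K * (t - a))).mul
        (w.continuous.Icc_extend' )))
    exact this.aestronglyMeasurable
  · exact ae_of_all _ fun t => hC _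

theorem integrable_max_sub_mul {f : ℝ → ℝ} (hf : Integrable f (volOn a b)) (x : ℝ) :
    Integrable (fun t => max (x - t) 0 * f t) (volOn a b) := by
  refine hf.bdd_mul (c := |x| + |a| + |b|) (by fun_prop) ?_
  filter_upwards [ae_mem_volOn a b] with t ht
  rw [Real.norm_of_nonneg (le_max_right _ _)]
  refine max_le ?_ (by positivity)
  linarith [le_abs_self x, neg_abs_le a, ht.1, abs_nonneg b]

theorem continuous_integral_max_sub {f : ℝ → ℝ} (hf : Integrable f (volOn a b)) :
    Continuous fun x : Icc a b => ∫ t, max ((x : ℝ) - t) 0 * f t ∂volOn a b := by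
  refine continuous_of_dominated (bound := fun t => (b - a) * |f t|)
    (fun x => (integrable_max_sub_mul hf x).1) (fun x => ?_) (hf.abs.const_mul _)
    (ae_of_all _ fun t => by fun_prop)
  filter_upwards [ae_mem_volOn a b] with t ht
  rw [norm_mul, Real.norm_of_nonneg (le_max_right _ _), Real.norm_eq_abs]
  refine mul_le_mul_of_nonneg_right (max_le ?_ ?_) (abs_nonneg _) <;>
    linarith [x.2.1, x.2.2, ht.1, ht.2]

/-- The Volterra operator of the initial value problem with slope `s`, in weighted form. -/
noncomputable def volterraMap (hm : Integrable m (volOn a b)) (hΦ : Continuous Φ) {C : ℝ}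
    (hC : ∀ z, |Φ z| ≤ C) (w : C(Icc a b, ℝ)) : C(Icc a b, ℝ) where
  toFun x := Real.exp (-(K * (x - a))) *
    (s * (x - a) - ∫ t, max ((x : ℝ) - t) 0 * weightedRhs hab K m Φ w t ∂volOn a b)
  continuous_toFun := by
    have := continuous_integral_max_sub (integrable_weightedRhs hab K hm hΦ hC w)
    fun_prop

theorem dist_volterraMap_le {K : ℝ} (hK : 0 < K) (hm : Integrable m (volOn a b))
    (hΦ : Continuous Φ) {C : ℝ} (hC : ∀ z, |Φ z| ≤ C) {Lc : ℝ} (hL0 : 0 ≤ Lc)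
    (hL : ∀ t y z, |Φ (t, y) - Φ (t, z)| ≤ Lc * |y - z|) (w w' : C(Icc a b, ℝ)) :
    dist (volterraMap hab K s hm hΦ hC w) (volterraMap hab K s hm hΦ hC w') ≤
      Lc * (∫ t, |m t| ∂volOn a b) / K * dist w w' := by
  have hI : 0 ≤ ∫ t, |m t| ∂volOn a b := integral_nonneg fun _ => abs_nonneg _
  rw [ContinuousMap.dist_le (by positivity)]
  intro x
  have i1 := integrable_weightedRhs hab K hm hΦ hC w
  have i2 := integrable_weightedRhs hab K hm hΦ hC w'
  have e : volterraMap hab K s hm hΦ hC w x - volterraMap hab K s hm hΦ hC w' x =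
      ∫ t, Real.exp (-(K * (x - a))) * (max ((x : ℝ) - t) 0 *
        (weightedRhs hab K m Φ w' t - weightedRhs hab K m Φ w t)) ∂volOn a b := by
    simp only [mul_sub]
    rw [integral_sub ((integrable_max_sub_mul i2 x).const_mul _)
      ((integrable_max_sub_mul i1 x).const_mul _), integral_const_mul, integral_const_mul]
    simp only [volterraMap, ContinuousMap.coe_mk]
    ring_nf
  rw [Real.dist_eq, e, ← Real.norm_eq_abs]
  refine (norm_integral_le_of_norm_le (hm.abs.const_mul (Lc / K * dist w w')) ?_).trans ?_
  · filter_upwards [ae_mem_volOn a b] with t ht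
    have h1 : |weightedRhs hab K m Φ w' t - weightedRhs hab K m Φ w t| ≤
        |m t| * (Lc * (Real.exp (K * (t - a)) * dist w w')) := by
      rw [weightedRhs, weightedRhs, ← mul_sub, abs_mul]
      refine mul_le_mul_of_nonneg_left ((hL _ _ _).trans ?_) (abs_nonneg _)
      refine mul_le_mul_of_nonneg_left ?_ hL0
      rw [← mul_sub, abs_mul, abs_of_pos (Real.exp_pos _)]
      refine mul_le_mul_of_nonneg_left ?_ (Real.exp_pos _).le
      rw [abs_sub_comm, ← Real.dist_eq]
      exact ContinuousMap.dist_apply_le_dist _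
    rw [norm_mul, norm_mul, Real.norm_of_nonneg (Real.exp_pos _).le,
      Real.norm_of_nonneg (le_max_right _ _), Real.norm_eq_abs]
    calc _ ≤ Real.exp (-(K * (x - a))) * (max ((x : ℝ) - t) 0 *
          (|m t| * (Lc * (Real.exp (K * (t - a)) * dist w w')))) := by gcongr
      _ = (max ((x : ℝ) - t) 0 * Real.exp (-(K * (x - t)))) * (Lc * dist w w' * |m t|) := by
          rw [show -(K * ((x : ℝ) - t)) = -(K * (x - a)) + K * (t - a) by ring, Real.exp_add]
          ring
      _ ≤ 1 / K * (Lc * dist w w' * |m t|) := by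
          gcongr
          exact max_sub_mul_exp_le hK _ _
      _ = _ := by ring
  · rw [integral_const_mul]
    apply le_of_eq
    ring

/-- Together with the uniform contraction, this makes the fixed point continuous in the slope, as
shooting requires. -/
theorem dist_volterraMap_slope_le {K : ℝ} (hK : 0 < K) (hm : Integrable m (volOn a b))
    (hΦ : Continuous Φ) {C : ℝ} (hC : ∀ z, |Φ z| ≤ C) (s s' : ℝ) (w : C(Icc a b, ℝ)) :
    dist (volterraMap hab K s hm hΦ hC w) (volterraMap hab K s' hm hΦ hC w) ≤
      (b - a) * |s - s'| := by
  rw [ContinuousMap.dist_le (mul_nonneg (by linarith) (abs_nonneg _))]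
  intro x
  simp only [volterraMap, ContinuousMap.coe_mk, Real.dist_eq]
  rw [← mul_sub, sub_sub_sub_cancel_right, ← sub_mul, abs_mul, abs_of_pos (Real.exp_pos _), abs_mul]
  have h1 : Real.exp (-(K * (x - a))) ≤ 1 := by
    rw [Real.exp_le_one_iff]
    have := x.2.1
    have : 0 ≤ K * (x - a) := mul_nonneg hK.le (by linarith)
    linarith
  have h2 : |(x : ℝ) - a| ≤ b - a := by
    rw [abs_of_nonneg (by linarith [x.2.1])]; linarith [x.2.2]
  calc _ ≤ 1 * (|s - s'| * (b - a)) := by gcongr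
    _ = _ := by ring

end Volterra

/-- The Dirichlet problem `-u'' = m Φ(t, u)` with `m` integrable and `Φ` bounded and Lipschitz. -/
theorem exists_eq_integral_green {a b : ℝ} (hab : a < b) {m : ℝ → ℝ}
    (hm : Integrable m (volOn a b)) {Φ : ℝ × ℝ → ℝ} (hΦ : Continuous Φ) {C : ℝ}
    (hC : ∀ z, |Φ z| ≤ C) {Lc : ℝ} (hL0 : 0 ≤ Lc)
    (hL : ∀ t y z, |Φ (t, y) - Φ (t, z)| ≤ Lc * |y - z|) :
    ∃ u : ℝ → ℝ, Continuous u ∧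
      ∀ x ∈ Icc a b, u x = ∫ t, green a b x t * (m t * Φ (t, u t)) ∂volOn a b := by
  set I := ∫ t, |m t| ∂volOn a b with hIdef
  have hI : 0 ≤ I := integral_nonneg fun _ => abs_nonneg _
  -- Chosen so that Lc I / K ≤ 1/2; the added 1 keeps K positive when Lc I = 0.
  set K := 2 * (Lc * I) + 1 with hKdef
  have hK : 0 < K := by positivity
  have : Nonempty (Icc a b) := ⟨⟨a, left_mem_Icc.2 hab.le⟩⟩
  set T := fun s : ℝ => volterraMap hab K s hm hΦ hC with hT
  have hcontr : ∀ s, ContractingWith (1 / 2) (T s) := fun s => by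
    refine ⟨by rw [← NNReal.coe_lt_coe]; norm_num, LipschitzWith.of_dist_le_mul fun w w' => ?_⟩
    refine (dist_volterraMap_le hab s hK hm hΦ hC hL0 hL w w').trans ?_
    refine mul_le_mul_of_nonneg_right ?_ dist_nonneg
    rw [div_le_iff₀ hK]
    push_cast
    linarith
  set W := fun s : ℝ => ContractingWith.fixedPoint (T s) (hcontr s) with hW
  have hfix : ∀ s, T s (W s) = W s := fun s => (hcontr s).fixedPoint_isFixedPt
  have hWc : Continuous W := by
    refine (LipschitzWith.of_dist_le_mul (K := Real.nnabs (2 * (b - a))) fun s s' => ?_).continuous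
    refine ((hcontr s).fixedPoint_lipschitz_in_map (hcontr s')
      (dist_volterraMap_slope_le hab hK hm hΦ hC s s')).trans (le_of_eq ?_)
    rw [Real.dist_eq, Real.coe_nnabs, abs_of_pos (by linarith : 0 < 2 * (b - a))]
    push_cast
    ring
  let xb : Icc a b := ⟨b, right_mem_Icc.2 hab.le⟩
  set J := fun s : ℝ => ∫ t, max (b - t) 0 * weightedRhs hab K m Φ (W s) t ∂volOn a b with hJ
  have hC0 : 0 ≤ C := (abs_nonneg _).trans (hC (0, 0))
  have hJb : ∀ s, |J s| ≤ (b - a) * C * I := fun s => by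
    rw [hJ, ← Real.norm_eq_abs]
    refine (norm_integral_le_of_norm_le (hm.abs.const_mul ((b - a) * C)) ?_).trans
      (le_of_eq (integral_const_mul _ _))
    filter_upwards [ae_mem_volOn a b] with t ht
    rw [norm_mul, Real.norm_of_nonneg (le_max_right _ _), weightedRhs, norm_mul,
      Real.norm_eq_abs, Real.norm_eq_abs]
    have h1 : max (b - t) 0 ≤ b - a := max_le (by linarith [ht.1]) (by linarith)
    calc _ ≤ (b - a) * (|m t| * C) := by
          gcongr
          exact hC _
      _ = _ := by ring
  have hWb : ∀ s, W s xb = Real.exp (-(K * (b - a))) * (s * (b - a) - J s) := fun s => by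
    conv_lhs => rw [← hfix s]
    rfl
  have hba : 0 < b - a := by linarith
  -- Because Φ is bounded, |J s| ≤ (b - a) C I for every slope, so the value at b has opposite weak
  -- signs at the slopes ±C I and vanishes in between.
  obtain ⟨s, hs⟩ : (0 : ℝ) ∈ range fun s => W s xb := by
    refine mem_range_of_exists_le_of_exists_ge
      ((continuous_eval_const xb).comp hWc) ⟨-(C * I), ?_⟩ ⟨C * I, ?_⟩
    · rw [hWb]
      refine mul_nonpos_of_nonneg_of_nonpos (Real.exp_pos _).le ?_
      linarith [(abs_le.1 (hJb (-(C * I)))).1]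
    · rw [hWb]
      refine mul_nonneg (Real.exp_pos _).le ?_
      linarith [(abs_le.1 (hJb (C * I))).2]
  simp only [hWb] at hs
  have hs' : s * (b - a) = J s := by
    rcases mul_eq_zero.1 hs with h | h
    · exact absurd h (Real.exp_pos _).ne'
    · linarith
  refine ⟨fun x => Real.exp (K * (x - a)) * IccExtend hab.le (W s) x, ?_, fun x hx => ?_⟩
  · exact (by fun_prop : Continuous fun t => Real.exp (K * (t - a))).mul
      ((W s).continuous.Icc_extend')
  have hi := integrable_weightedRhs hab K hm hΦ hC (W s)
  have h1 : IccExtend hab.le (W s) x = Real.exp (-(K * (x - a))) *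
      (s * (x - a) - ∫ t, max (x - t) 0 * weightedRhs hab K m Φ (W s) t ∂volOn a b) := by
    rw [IccExtend_of_mem _ _ hx]
    conv_lhs => rw [← hfix s]
    rfl
  have h2 : ∫ t, green a b x t * weightedRhs hab K m Φ (W s) t ∂volOn a b =
      (x - a) / (b - a) * J s -
        ∫ t, max (x - t) 0 * weightedRhs hab K m Φ (W s) t ∂volOn a b := by
    rw [hJ, ← integral_const_mul, ← integral_sub ((integrable_max_sub_mul hi b).const_mul _)
      (integrable_max_sub_mul hi x)]
    refine integral_congr_ae ?_
    filter_upwards [ae_mem_volOn a b] with t ht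
    rw [green_eq_sub hab, max_eq_left (by linarith [ht.2] : 0 ≤ b - t)]
    ring
  simp only
  rw [h1, ← mul_assoc, ← Real.exp_add, add_neg_cancel, Real.exp_zero, one_mul]
  refine Eq.trans ?_ h2.symm
  rw [← hs']
  field_simp

/-! ### Bounds on Green's function, compactness and the truncated problem -/

/-- Distance to the endpoints of `(a, b)`, for points of the interval. -/
noncomputable def endDist (a b t : ℝ) : ℝ := min (t - a) (b - t)

theorem continuous_endDist (a b : ℝ) : Continuous (endDist a b) := by
  unfold endDist; fun_prop

theorem endDist_pos {a b t : ℝ} (ht : t ∈ Ioo a b) : 0 < endDist a b t :=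
  lt_min (by linarith [ht.1]) (by linarith [ht.2])

theorem endDist_nonneg {a b t : ℝ} (ht : t ∈ Icc a b) : 0 ≤ endDist a b t :=
  le_min (by linarith [ht.1]) (by linarith [ht.2])

theorem endDist_le {a b : ℝ} (t : ℝ) : endDist a b t ≤ (b - a) / 2 := by
  rcases le_total (t - a) (b - t) with h | h
  · exact (min_le_left _ _).trans (by linarith)
  · exact (min_le_right _ _).trans (by linarith)

theorem continuous_green (a b : ℝ) : Continuous fun z : ℝ × ℝ => green a b z.1 z.2 := by
  unfold green; fun_prop

theorem continuous_green_left (a b t : ℝ) : Continuous fun x => green a b x t :=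
  (continuous_green a b).comp (by fun_prop : Continuous fun x : ℝ => (x, t))

theorem continuous_green_right (a b x : ℝ) : Continuous fun t => green a b x t :=
  (continuous_green a b).comp (by fun_prop : Continuous fun t : ℝ => (x, t))

theorem green_nonneg {a b x t : ℝ} (hab : a < b) (hx : x ∈ Icc a b) (ht : t ∈ Icc a b) :
    0 ≤ green a b x t :=
  div_nonneg (mul_nonneg (sub_nonneg.2 (le_min hx.1 ht.1)) (sub_nonneg.2 (max_le hx.2 ht.2)))
    (by linarith)

/-- The factor x - a is δ(x) when a is the nearer endpoint. The factor b - t that remains is the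
source of the weight m⁻_b; the companion bound gives m⁻_a. -/
theorem green_le_right_mul {a b x t : ℝ} (hab : a < b) (hx : x ∈ Icc a b) (ht : t ∈ Icc a b) :
    green a b x t ≤ (x - a) * (b - t) / (b - a) := by
  have h : 0 ≤ b - max x t := sub_nonneg.2 (max_le hx.2 ht.2)
  have h0 : 0 ≤ x - a := by linarith [hx.1]
  rw [green]
  refine div_le_div_of_nonneg_right ?_ (by linarith)
  gcongr
  · exact min_le_left _ _
  · exact le_max_right _ _

theorem green_le_left_mul {a b x t : ℝ} (hab : a < b) (hx : x ∈ Icc a b) (ht : t ∈ Icc a b) :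
    green a b x t ≤ (b - x) * (t - a) / (b - a) := by
  rw [green, mul_comm]
  refine div_le_div_of_nonneg_right ?_ (by linarith)
  have h1 : 0 ≤ min x t - a := sub_nonneg.2 (le_min hx.1 ht.1)
  have h2 : 0 ≤ b - x := by linarith [hx.2]
  gcongr
  · exact le_max_left _ _
  · exact min_le_right _ _

theorem green_le_endDist {a b x t : ℝ} (hab : a < b) (hx : x ∈ Icc a b) (ht : t ∈ Icc a b) :
    green a b x t ≤ endDist a b t := by
  have hba : 0 < b - a := by linarith
  refine le_min ((green_le_left_mul hab hx ht).trans ?_) ((green_le_right_mul hab hx ht).trans ?_)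
  · rw [div_le_iff₀ hba, mul_comm]
    exact mul_le_mul_of_nonneg_left (by linarith [hx.1]) (by linarith [ht.1])
  · rw [div_le_iff₀ hba, mul_comm]
    exact mul_le_mul_of_nonneg_left (by linarith [hx.2]) (by linarith [ht.2])

theorem endDist_mul_endDist_le_green {a b x t : ℝ} (hab : a < b) (hx : x ∈ Icc a b)
    (ht : t ∈ Icc a b) : endDist a b x * endDist a b t / (b - a) ≤ green a b x t := by
  rw [green]
  refine div_le_div_of_nonneg_right ?_ (by linarith)
  have h1 := endDist_nonneg hx
  have h2 := endDist_nonneg ht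
  rcases le_total x t with h | h
  · rw [min_eq_left h, max_eq_right h]
    exact mul_le_mul (min_le_left _ _) (min_le_right _ _) h2 (by linarith [hx.1])
  · rw [min_eq_right h, max_eq_left h, mul_comm]
    exact mul_le_mul (min_le_left _ _) (min_le_right _ _) h1 (by linarith [ht.1])

theorem exists_lipschitz_rpow_neg {γ ε : ℝ} (hγ : 0 < γ) (hε : 0 < ε) :
    ∃ C, 0 ≤ C ∧ ∀ p q, ε ≤ p → ε ≤ q → |p ^ (-γ) - q ^ (-γ)| ≤ C * |p - q| := by
  refine ⟨γ * ε ^ (-γ - 1), by positivity, fun p q hp hq => ?_⟩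
  have := Convex.norm_image_sub_le_of_norm_hasDerivWithin_le (s := Ici ε)
    (f := fun x : ℝ => x ^ (-γ)) (f' := fun x => -γ * x ^ (-γ - 1)) (C := γ * ε ^ (-γ - 1))
    (fun x hx => (Real.hasDerivAt_rpow_const
      (Or.inl (hε.trans_le hx).ne')).hasDerivWithinAt) (fun x hx => ?_) (convex_Ici ε) hq hp
  · simpa only [Real.norm_eq_abs] using this
  · have hx0 : 0 < x := hε.trans_le hx
    rw [norm_mul, norm_neg, Real.norm_of_nonneg hγ.le,
      Real.norm_of_nonneg (Real.rpow_nonneg hx0.le _)]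
    exact mul_le_mul_of_nonneg_left
      (Real.rpow_le_rpow_of_nonpos hε hx (by linarith)) hγ.le

/-- As γ < 1, the power δ^(1-γ) is bounded: the decay of Green's function at the boundary absorbs
the singularity, and m need only be integrable. -/
theorem integrable_endDist_mul {a b k γ : ℝ} (hk : 0 < k) (hγ : γ < 1)
    {m : ℝ → ℝ} (hm : Integrable m (volOn a b)) :
    Integrable (fun t => endDist a b t * (|m t| * (k * endDist a b t) ^ (-γ))) (volOn a b) := by
  have hc := continuous_endDist a b
  refine (hm.abs.mul_const (k ^ (-γ) * ((b - a) / 2) ^ (1 - γ))).mono' ?_ ?_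
  · have h1 : Measurable fun t => (k * endDist a b t) ^ (-γ) :=
      (hc.measurable.const_mul k).pow_const _
    exact hc.aestronglyMeasurable.mul (hm.1.norm.mul h1.aestronglyMeasurable)
  · filter_upwards [ae_mem_volOn a b] with t ht
    have hd := endDist_pos ht
    rw [Real.norm_of_nonneg (by positivity), Real.mul_rpow hk.le hd.le]
    have h2 : endDist a b t * endDist a b t ^ (-γ) = endDist a b t ^ (1 - γ) := by
      rw [sub_eq_add_neg, Real.rpow_add hd, Real.rpow_one]
    calc _ = |m t| * (k ^ (-γ) * (endDist a b t * endDist a b t ^ (-γ))) := by ring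
      _ ≤ _ := by
        rw [h2]
        gcongr
        exact endDist_le t

theorem abs_green_sub_le {a b x y t : ℝ} (hab : a < b) (hx : x ∈ Icc a b) (hy : y ∈ Icc a b)
    (ht : t ∈ Icc a b) : |green a b x t - green a b y t| ≤ endDist a b t := by
  rw [abs_le]
  constructor <;> linarith [green_le_endDist hab hx ht, green_le_endDist hab hy ht,
    green_nonneg hab hx ht, green_nonneg hab hy ht]

/-- Compactness of the Green operator on the functions dominated by `h`. -/
theorem exists_subseq_tendsto_of_green {a b : ℝ} (hab : a < b) {h : ℝ → ℝ}
    (h0 : ∀ t ∈ Ioo a b, 0 ≤ h t) (hhm : AEStronglyMeasurable h (volOn a b))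
    (hh : Integrable (fun t => endDist a b t * h t) (volOn a b))
    {u : ℕ → ℝ → ℝ} {f : ℕ → ℝ → ℝ} (hu : ∀ n, Continuous (u n))
    (hfm : ∀ n, AEStronglyMeasurable (f n) (volOn a b))
    (hfh : ∀ n, ∀ t ∈ Ioo a b, |f n t| ≤ h t)
    (huf : ∀ n, ∀ x ∈ Icc a b, u n x = ∫ t, green a b x t * f n t ∂volOn a b) :
    ∃ (U : ℝ → ℝ) (φ : ℕ → ℕ), Continuous U ∧ StrictMono φ ∧
      ∀ x ∈ Icc a b, Tendsto (fun n => u (φ n) x) atTop (𝓝 (U x)) := by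
  set R := ∫ t, endDist a b t * h t ∂volOn a b with hR
  have hgi : ∀ n, ∀ x ∈ Icc a b, Integrable (fun t => green a b x t * f n t) (volOn a b) :=
    fun n x hx => by
      refine hh.mono' ((continuous_green_right a b x).aestronglyMeasurable.mul (hfm n)) ?_
      filter_upwards [ae_mem_volOn a b] with t ht
      have ht' := Ioo_subset_Icc_self ht
      rw [norm_mul, Real.norm_of_nonneg (green_nonneg hab hx ht')]
      exact mul_le_mul (green_le_endDist hab hx ht') (hfh n t ht) (abs_nonneg _)
        (endDist_nonneg ht')
  let V : ℕ → BoundedContinuousFunction (Icc a b) ℝ := fun n =>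
    BoundedContinuousFunction.mkOfCompact ⟨fun x => u n x, (hu n).comp continuous_subtype_val⟩
  have hcompact := BoundedContinuousFunction.arzela_ascoli (Metric.closedBall (0 : ℝ) R)
    (isCompact_closedBall _ _) (range V) ?_ ?_
  · obtain ⟨U, -, φ, hφ, hlim⟩ := hcompact.tendsto_subseq
      (x := V) fun n => subset_closure (mem_range_self n)
    refine ⟨IccExtend hab.le U, φ, U.continuous.Icc_extend', hφ, fun x hx => ?_⟩
    rw [IccExtend_of_mem _ _ hx]
    exact ((continuous_eval_const (F := BoundedContinuousFunction (Icc a b) ℝ)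
      (⟨x, hx⟩ : Icc a b)).tendsto U).comp hlim
  · rintro _ x ⟨n, rfl⟩
    rw [mem_closedBall_zero_iff]
    change ‖u n x‖ ≤ R
    rw [huf n x x.2]
    refine norm_integral_le_of_norm_le hh ?_
    filter_upwards [ae_mem_volOn a b] with t ht
    have ht' := Ioo_subset_Icc_self ht
    rw [norm_mul, Real.norm_of_nonneg (green_nonneg hab x.2 ht')]
    exact mul_le_mul (green_le_endDist hab x.2 ht') (hfh n t ht) (abs_nonneg _)
      (endDist_nonneg ht')
  · intro x
    have hmeas : ∀ y : ℝ, AEStronglyMeasurable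
        (fun t => |green a b x t - green a b y t| * h t) (volOn a b) := fun y =>
      ((continuous_green_right a b x).sub
        (continuous_green_right a b y)).abs.aestronglyMeasurable.mul hhm
    have hbd : ∀ y : Icc a b, ∀ᵐ t ∂volOn a b,
        ‖|green a b x t - green a b y t| * h t‖ ≤ endDist a b t * h t := fun y => by
      filter_upwards [ae_mem_volOn a b] with t ht
      rw [norm_mul, Real.norm_of_nonneg (abs_nonneg _), Real.norm_of_nonneg (h0 t ht)]
      exact mul_le_mul_of_nonneg_right
        (abs_green_sub_le hab x.2 y.2 (Ioo_subset_Icc_self ht)) (h0 t ht)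
    -- This integral is a modulus of continuity at x common to all n, and it vanishes at y = x.
    have hω : Continuous fun y : Icc a b =>
        ∫ t, |green a b x t - green a b y t| * h t ∂volOn a b := by
      refine continuous_of_dominated (fun y => hmeas y) hbd hh (ae_of_all _ fun t => ?_)
      have := (continuous_green_left a b t).comp (continuous_subtype_val (p := fun z => z ∈ Icc a b))
      exact (continuous_const.sub this).abs.mul continuous_const
    rw [Metric.equicontinuousAt_iff]
    intro ε hε
    have h1 := hω.tendsto x
    simp only [sub_self, abs_zero, zero_mul, integral_zero] at h1
    obtain ⟨d, hd, hd'⟩ := Metric.eventually_nhds_iff.1 (h1.eventually (gt_mem_nhds hε))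
    refine ⟨d, hd, fun y hy => ?_⟩
    rintro ⟨_, n, rfl⟩
    refine lt_of_le_of_lt ?_ (hd' hy)
    change dist (u n x) (u n y) ≤ _
    rw [Real.dist_eq, huf n x x.2, huf n y y.2, ← integral_sub (hgi n x x.2) (hgi n y y.2),
      ← Real.norm_eq_abs]
    refine norm_integral_le_of_norm_le (hh.mono' (hmeas y) (hbd y)) ?_
    filter_upwards [ae_mem_volOn a b] with t ht
    rw [← sub_mul, norm_mul]
    exact mul_le_mul_of_nonneg_left (hfh n t ht) (norm_nonneg _)

/-- The singular problem with the nonlinearity truncated below by `k` times the distance to the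
boundary. -/
theorem exists_truncated_solution {a b k γ : ℝ} (hab : a < b) (hk : 0 < k) (hγ : 0 < γ)
    (hγ1 : γ < 1) {m : ℝ → ℝ} (hm : Integrable m (volOn a b)) :
    ∃ u : ℝ → ℝ, Continuous u ∧ ∀ x ∈ Icc a b,
      u x = ∫ t, green a b x t * (m t * max (u t) (k * endDist a b t) ^ (-γ)) ∂volOn a b := by
  set ε : ℕ → ℝ := fun n => 1 / ((n : ℝ) + 1) with hεdef
  have hε : ∀ n, 0 < ε n := fun n => by positivity
  have hdc := continuous_endDist a b
  -- The floor ε n makes the nonlinearity bounded and Lipschitz even at the endpoints, where kδ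
  -- vanishes. The floor kδ is kept because it yields a dominating function independent of n.
  set Φ : ℕ → ℝ × ℝ → ℝ := fun n z => max z.2 (max (k * endDist a b z.1) (ε n)) ^ (-γ) with hΦ
  have hle : ∀ n (z : ℝ × ℝ), ε n ≤ max z.2 (max (k * endDist a b z.1) (ε n)) := fun n z =>
    (le_max_right _ _).trans (le_max_right _ _)
  have hΦc : ∀ n, Continuous (Φ n) := fun n => by
    refine Continuous.rpow_const (by fun_prop) fun z => Or.inl ?_
    exact ((hε n).trans_le (hle n z)).ne'
  have hex : ∀ n, ∃ u : ℝ → ℝ, Continuous u ∧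
      ∀ x ∈ Icc a b, u x = ∫ t, green a b x t * (m t * Φ n (t, u t)) ∂volOn a b := fun n => by
    obtain ⟨C, hC0, hC⟩ := exists_lipschitz_rpow_neg hγ (hε n)
    refine exists_eq_integral_green hab hm (hΦc n) (C := ε n ^ (-γ)) (fun z => ?_) hC0
      fun t y z => (hC _ _ (hle n (t, y)) (hle n (t, z))).trans ?_
    · rw [hΦ]
      simp only
      rw [abs_of_nonneg (Real.rpow_nonneg ((hε n).le.trans (hle n z)) _)]
      exact Real.rpow_le_rpow_of_nonpos (hε n) (hle n z) (by linarith)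
    · exact mul_le_mul_of_nonneg_left (abs_max_sub_max_le_abs _ _ _) hC0
  choose u huc hu using hex
  set h : ℝ → ℝ := fun t => |m t| * (k * endDist a b t) ^ (-γ) with hh
  have hhm : AEStronglyMeasurable h (volOn a b) :=
    hm.1.norm.mul ((hdc.measurable.const_mul k).pow_const _).aestronglyMeasurable
  have hhi : Integrable (fun t => endDist a b t * h t) (volOn a b) :=
    integrable_endDist_mul hk hγ1 hm
  have hfm : ∀ n, AEStronglyMeasurable (fun t => m t * Φ n (t, u n t)) (volOn a b) := fun n =>
    hm.1.mul ((hΦc n).comp (continuous_id.prodMk (huc n))).aestronglyMeasurable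
  have hfh : ∀ n, ∀ t ∈ Ioo a b, |m t * Φ n (t, u n t)| ≤ h t := fun n t ht => by
    have hd : 0 < k * endDist a b t := mul_pos hk (endDist_pos ht)
    rw [abs_mul, hΦ]
    simp only
    rw [abs_of_nonneg (Real.rpow_nonneg ((hε n).le.trans (hle n (t, u n t))) _)]
    refine mul_le_mul_of_nonneg_left ?_ (abs_nonneg _)
    exact Real.rpow_le_rpow_of_nonpos hd ((le_max_left _ _).trans (le_max_right _ _))
      (by linarith)
  obtain ⟨U, φ, hUc, hφ, hlim⟩ := exists_subseq_tendsto_of_green hab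
    (fun t ht => (abs_nonneg _).trans (hfh 0 t ht)) hhm hhi huc hfm hfh hu
  refine ⟨U, hUc, fun x hx => tendsto_nhds_unique (hlim x hx) ?_⟩
  have hεlim : Tendsto (fun n => ε (φ n)) atTop (𝓝 0) :=
    tendsto_one_div_add_atTop_nhds_zero_nat.comp hφ.tendsto_atTop
  simp only [fun n => hu n x hx]
  refine tendsto_integral_of_dominated_convergence (fun t => endDist a b t * h t)
    (fun n => (continuous_green_right a b x).aestronglyMeasurable.mul (hfm _)) hhi
    (fun n => ?_) ?_
  · filter_upwards [ae_mem_volOn a b] with t ht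
    have ht' := Ioo_subset_Icc_self ht
    rw [norm_mul, Real.norm_of_nonneg (green_nonneg hab hx ht')]
    exact mul_le_mul (green_le_endDist hab hx ht') (hfh _ t ht) (abs_nonneg _)
      (endDist_nonneg ht')
  · filter_upwards [ae_mem_volOn a b] with t ht
    have hd : 0 < k * endDist a b t := mul_pos hk (endDist_pos ht)
    have h1 : Tendsto (fun n => max (u (φ n) t) (max (k * endDist a b t) (ε (φ n)))) atTop
        (𝓝 (max (U t) (max (k * endDist a b t) 0))) :=
      (hlim t (Ioo_subset_Icc_self ht)).max (tendsto_const_nhds.max hεlim)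
    rw [max_eq_left hd.le] at h1
    exact ((h1.rpow_const (Or.inl (hd.trans_le (le_max_right _ _)).ne')).const_mul _).const_mul _

/-! ### Green potentials solve the equation -/

/-- The derivative of Green's function in its first variable. -/
noncomputable def dgreen (a b x t : ℝ) : ℝ :=
  if t ≤ x then -((t - a) / (b - a)) else (b - t) / (b - a)

theorem measurable_dgreen (a b x : ℝ) : Measurable (dgreen a b x) :=
  Measurable.ite measurableSet_Iic (by fun_prop) (by fun_prop)

theorem abs_dgreen_le_one {a b x t : ℝ} (ht : t ∈ Ioo a b) : |dgreen a b x t| ≤ 1 := by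
  have hba : 0 < b - a := by linarith [ht.1, ht.2]
  unfold dgreen
  split_ifs
  · rw [abs_neg, abs_of_nonneg (div_nonneg (by linarith [ht.1]) hba.le), div_le_one hba]
    linarith [ht.2]
  · rw [abs_of_nonneg (div_nonneg (by linarith [ht.2]) hba.le), div_le_one hba]
    linarith [ht.1]

/-- For fixed interior x the kernel still decays like δ(t). Hence the derivative of the potential is
finite when only δ f, and not f, is integrable. -/
theorem abs_dgreen_le {a b x t : ℝ} (hx : x ∈ Ioo a b) (ht : t ∈ Ioo a b) :
    |dgreen a b x t| ≤ endDist a b t * (1 / (b - a) + 1 / (x - a) + 1 / (b - x)) := by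
  have hba : 0 < b - a := by linarith [ht.1, ht.2]
  have h1 : 0 < x - a := by linarith [hx.1]
  have h2 : 0 < b - x := by linarith [hx.2]
  have h3 : 0 < t - a := by linarith [ht.1]
  have h4 : 0 < b - t := by linarith [ht.2]
  have hd := endDist_pos ht
  have hsum : endDist a b t * (1 / (b - a) + 1 / (x - a) + 1 / (b - x)) =
    endDist a b t / (b - a) + endDist a b t / (x - a) + endDist a b t / (b - x) := by ring
  have e1 : 0 < endDist a b t / (b - a) := by positivity
  have e2 : 0 < endDist a b t / (x - a) := by positivity
  have e3 : 0 < endDist a b t / (b - x) := by positivity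
  rw [hsum]
  have hone := abs_dgreen_le_one (x := x) ht
  rcases le_total (t - a) (b - t) with h | h
  · have he : endDist a b t = t - a := min_eq_left h
    by_cases htx : t ≤ x
    · have : |dgreen a b x t| = (t - a) / (b - a) := by
        rw [dgreen, if_pos htx, abs_neg, abs_of_pos (by positivity)]
      rw [← he] at this
      linarith
    · have : 1 ≤ endDist a b t / (x - a) := by
        rw [he, one_le_div h1]; linarith
      linarith
  · have he : endDist a b t = b - t := min_eq_right h
    by_cases htx : t ≤ x
    · have : 1 ≤ endDist a b t / (b - x) := by
        rw [he, one_le_div h2]; linarith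
      linarith
    · have : |dgreen a b x t| = (b - t) / (b - a) := by
        rw [dgreen, if_neg htx, abs_of_pos (by positivity)]
      rw [← he] at this
      linarith

theorem dgreen_sub_dgreen {a b x y t : ℝ} (hab : a < b) (hxy : x ≤ y) :
    dgreen a b y t - dgreen a b x t = (Ioc x y).indicator (fun _ => (-1 : ℝ)) t := by
  have hba : b - a ≠ 0 := by linarith
  unfold dgreen
  by_cases h1 : t ≤ x
  · rw [if_pos h1, if_pos (h1.trans hxy), indicator_of_notMem fun h => not_lt.2 h1 h.1]; ring
  · by_cases h2 : t ≤ y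
    · rw [if_neg h1, if_pos h2, indicator_of_mem (show t ∈ Ioc x y from ⟨not_le.1 h1, h2⟩)]; field_simp; ring
    · rw [if_neg h1, if_neg h2, indicator_of_notMem fun h => h2 h.2]; ring

/-- A first-order Taylor formula with exact remainder, supported in (x, y]. It replaces
differentiation under the integral sign. -/
theorem green_sub_green {a b x y t : ℝ} (hab : a < b) (hxy : x ≤ y) :
    green a b y t - green a b x t =
      (y - x) * dgreen a b x t - (Ioc x y).indicator (fun t => y - t) t := by
  have hba : b - a ≠ 0 := by linarith
  rw [green_eq_sub hab, green_eq_sub hab]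
  unfold dgreen
  by_cases h1 : t ≤ x
  · rw [if_pos h1, indicator_of_notMem fun h => not_lt.2 h1 h.1, max_eq_left (by linarith),
      max_eq_left (by linarith)]
    field_simp; ring
  · have h1' := not_le.1 h1
    rw [if_neg h1, max_eq_right (by linarith : x - t ≤ 0)]
    by_cases h2 : t ≤ y
    · rw [indicator_of_mem (show t ∈ Ioc x y from ⟨h1', h2⟩), max_eq_left (by linarith)]; ring
    · rw [indicator_of_notMem fun h => h2 h.2, max_eq_right (by linarith)]; ring

theorem integral_indicator_Ioc_mul {a b x y : ℝ} (hx : x ∈ Ioo a b) (hy : y ∈ Ioo a b)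
    (hxy : x ≤ y) (g f : ℝ → ℝ) :
    ∫ t, (Ioc x y).indicator g t * f t ∂volOn a b = ∫ t in x..y, g t * f t := by
  rw [intervalIntegral.integral_of_le hxy, volOn]
  have : ∀ t, (Ioc x y).indicator g t * f t = (Ioc x y).indicator (fun t => g t * f t) t :=
    fun t => by by_cases h : t ∈ Ioc x y <;> simp [h]
  simp only [this]
  rw [integral_indicator measurableSet_Ioc, Measure.restrict_restrict measurableSet_Ioc,
    inter_eq_left.2 (show Ioc x y ⊆ Ioo a b from
      fun t ht => ⟨hx.1.trans ht.1, ht.2.trans_lt hy.2⟩)]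

theorem isPrimitiveOn_of_le {a b : ℝ} {v f : ℝ → ℝ}
    (h : ∀ x ∈ Ioo a b, ∀ y ∈ Ioo a b, x ≤ y → v y - v x = ∫ t in x..y, f t) :
    IsPrimitiveOn a b v f := by
  intro x hx y hy
  rcases le_total x y with hxy | hxy
  · exact h x hx y hy hxy
  · rw [intervalIntegral.integral_symm, ← h y hy x hx hxy]; ring

/-- A Green potential solves `-u'' = f`. -/
theorem isPrimitiveOn_green {a b : ℝ} (hab : a < b) {f u : ℝ → ℝ}
    (hf : LocallyIntegrableOn f (Ioo a b))
    (hd : Integrable (fun t => endDist a b t * f t) (volOn a b))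
    (hu : ∀ x ∈ Icc a b, u x = ∫ t, green a b x t * f t ∂volOn a b) :
    IsPrimitiveOn a b u (fun x => ∫ t, dgreen a b x t * f t ∂volOn a b) ∧
      IsPrimitiveOn a b (fun x => ∫ t, dgreen a b x t * f t ∂volOn a b) (-f) := by
  have hfm : AEStronglyMeasurable f (volOn a b) := hf.aestronglyMeasurable
  have hdi : ∀ x ∈ Ioo a b, Integrable (fun t => dgreen a b x t * f t) (volOn a b) :=
    fun x hx => by
      refine (hd.norm.mul_const (1 / (b - a) + 1 / (x - a) + 1 / (b - x))).mono'
        ((measurable_dgreen a b x).aestronglyMeasurable.mul hfm) ?_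
      filter_upwards [ae_mem_volOn a b] with t ht
      rw [norm_mul, norm_mul, Real.norm_of_nonneg (endDist_pos ht).le, mul_right_comm]
      exact mul_le_mul_of_nonneg_right (abs_dgreen_le hx ht) (norm_nonneg _)
  have hgi : ∀ x ∈ Ioo a b, Integrable (fun t => green a b x t * f t) (volOn a b) :=
    fun x hx => by
      refine hd.norm.mono' ((continuous_green_right a b x).aestronglyMeasurable.mul hfm) ?_
      filter_upwards [ae_mem_volOn a b] with t ht
      have hx' := Ioo_subset_Icc_self hx
      have ht' := Ioo_subset_Icc_self ht
      rw [norm_mul, norm_mul, Real.norm_of_nonneg (endDist_pos ht).le,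
        Real.norm_of_nonneg (green_nonneg hab hx' ht')]
      exact mul_le_mul_of_nonneg_right (green_le_endDist hab hx' ht') (norm_nonneg _)
  have hv : IsPrimitiveOn a b (fun x => ∫ t, dgreen a b x t * f t ∂volOn a b) (-f) := by
    refine isPrimitiveOn_of_le fun x hx y hy hxy => ?_
    rw [← integral_sub (hdi y hy) (hdi x hx)]
    simp only [← sub_mul, dgreen_sub_dgreen hab hxy]
    rw [integral_indicator_Ioc_mul hx hy hxy]
    simp
  refine ⟨isPrimitiveOn_of_le fun x hx y hy hxy => ?_, hv⟩
  have hbd : ∀ t ∈ Ioo a b, ‖(Ioc x y).indicator (fun t => y - t) t‖ ≤ b - a := fun t ht => by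
    by_cases h : t ∈ Ioc x y
    · rw [indicator_of_mem h, Real.norm_of_nonneg (by linarith [h.2])]
      linarith [ht.1, hy.2]
    · rw [indicator_of_notMem h]; simp; linarith
  have hii : Integrable (fun t => (Ioc x y).indicator (fun t => y - t) t * f t) (volOn a b) := by
    have h1 := ((hgi y hy).sub (hgi x hx))
    have h2 := ((hdi x hx).const_mul (y - x)).sub h1
    refine h2.congr (ae_of_all _ fun t => ?_)
    have := green_sub_green (t := t) hab hxy
    simp only [Pi.sub_apply]
    rw [← sub_mul, this]; ring
  rw [hu x (Ioo_subset_Icc_self hx), hu y (Ioo_subset_Icc_self hy),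
    ← integral_sub (hgi y hy) (hgi x hx)]
  have e : ∀ t, green a b y t * f t - green a b x t * f t = (y - x) * (dgreen a b x t * f t) -
      (Ioc x y).indicator (fun t => y - t) t * f t := fun t => by
    rw [← sub_mul, green_sub_green hab hxy]; ring
  simp only [e]
  rw [integral_sub ((hdi x hx).const_mul _) hii, integral_const_mul,
    integral_indicator_Ioc_mul hx hy hxy]
  have hfi := hf.intervalIntegrable_of_mem_Ioo hx hy
  -- Integrating v by parts against s - y turns the integral of v over (x, y) into (y - x) v(x)
  -- minus ∫ (y - t) f, the same remainder.
  have key := integral_mul_deriv_of_primitive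
    (v := fun x => ∫ t, dgreen a b x t * f t ∂volOn a b) (g := fun s => s - y)
    (g' := fun _ => 1) hxy hfi.neg
    (fun z hz => by
      have := hv x hx z ⟨hx.1.trans_le hz.1, hz.2.trans_lt hy.2⟩
      linarith)
    (fun z _ => (hasDerivAt_id z).sub_const y) continuousOn_const
  simp only [mul_one, sub_self, mul_zero, zero_sub, Pi.neg_apply] at key
  rw [key]
  have e2 : ∫ t in x..y, -f t * (t - y) = ∫ t in x..y, (y - t) * f t := by
    refine intervalIntegral.integral_congr fun t _ => ?_
    ring
  rw [e2]
  ring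

/-! ### The upper bound -/

/-- The solution of the truncated problem may change sign, so the test with u^γ is made only on the
stretch of positivity adjacent to x₀, which starts at the last zero. -/
theorem exists_zero_left {a x₀ : ℝ} {u : ℝ → ℝ} (hax : a ≤ x₀)
    (hu : ContinuousOn u (Icc a x₀)) (ha : u a = 0) (hx₀ : 0 < u x₀) :
    ∃ c, a ≤ c ∧ c < x₀ ∧ u c = 0 ∧ ∀ x ∈ Ioc c x₀, 0 < u x := by
  have hcl : IsClosed (Icc a x₀ ∩ u ⁻¹' {0}) := hu.preimage_isClosed_of_isClosed isClosed_Icc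
    isClosed_singleton
  have hcomp : IsCompact (Icc a x₀ ∩ u ⁻¹' {0}) :=
    isCompact_Icc.of_isClosed_subset hcl inter_subset_left
  obtain ⟨c, ⟨hc, hc0⟩, hmax⟩ := hcomp.exists_isGreatest ⟨a, left_mem_Icc.2 hax, ha⟩
  have hc0' : u c = 0 := hc0
  refine ⟨c, hc.1, lt_of_le_of_ne hc.2 fun h => ?_, hc0', fun x hx => ?_⟩
  · rw [← h, hc0'] at hx₀; exact lt_irrefl _ hx₀
  · by_contra hneg
    have hsub : Icc x x₀ ⊆ Icc a x₀ := Icc_subset_Icc_left (hc.1.trans hx.1.le)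
    obtain ⟨z, hz, hz0⟩ := intermediate_value_Icc hx.2 (hu.mono hsub)
      (⟨not_lt.1 hneg, hx₀.le⟩ : (0 : ℝ) ∈ Icc (u x) (u x₀))
    exact absurd (hmax ⟨hsub hz, hz0⟩) (not_le.2 (hx.1.trans_le hz.1))

theorem exists_zero_right {b x₀ : ℝ} {u : ℝ → ℝ} (hxb : x₀ ≤ b)
    (hu : ContinuousOn u (Icc x₀ b)) (hb : u b = 0) (hx₀ : 0 < u x₀) :
    ∃ d, d ≤ b ∧ x₀ < d ∧ u d = 0 ∧ ∀ x ∈ Ico x₀ d, 0 < u x := by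
  obtain ⟨c, h1, h2, h3, h4⟩ := exists_zero_left (a := -b) (x₀ := -x₀) (u := fun x => u (-x))
    (by linarith) (hu.comp continuous_neg.continuousOn fun x hx =>
      ⟨by linarith [hx.2], by linarith [hx.1]⟩) (by simpa using hb) (by simpa using hx₀)
  refine ⟨-c, by linarith, by linarith, h3, fun x hx => ?_⟩
  have := h4 (-x) ⟨by linarith [hx.2], by linarith [hx.1]⟩
  simpa using this

/-- An upper bound for solutions of `-u'' = f` with `f u ^ γ ≤ h` where `u` is positive. -/
theorem rpow_le_of_mul_rpow_le {a b γ : ℝ} (hab : a < b) (hγ : 0 < γ) {u v f h : ℝ → ℝ}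
    (hu : ContinuousOn u (Icc a b)) (hua : u a = 0) (hub : u b = 0)
    (huv : IsPrimitiveOn a b u v) (hvf : IsPrimitiveOn a b v (-f))
    (hf : LocallyIntegrableOn f (Ioo a b)) (hh0 : ∀ x, 0 ≤ h x)
    (hh : IntervalIntegrable h volume a b)
    (hfh : ∀ x ∈ Ioo a b, 0 < u x → f x * u x ^ γ ≤ h x) {S : ℝ} (hS : 0 ≤ S)
    (hSh : (1 + γ) * ((b - a) / 4 * ∫ t in a..b, h t) ≤ S ^ (1 + γ)) :
    ∀ x ∈ Icc a b, u x ≤ S := by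
  obtain ⟨x₀, hx₀, hmax⟩ := isCompact_Icc.exists_isMaxOn (nonempty_Icc.2 hab.le) hu
  suffices u x₀ ≤ S from fun x hx => (hmax hx).trans this
  by_contra hlt
  rw [not_le] at hlt
  have hpos : 0 < u x₀ := hS.trans_lt hlt
  have hxI : x₀ ∈ Ioo a b := by
    refine ⟨lt_of_le_of_ne hx₀.1 fun h => ?_, lt_of_le_of_ne hx₀.2 fun h => ?_⟩
    · rw [← h, hua] at hpos; exact lt_irrefl _ hpos
    · rw [h, hub] at hpos; exact lt_irrefl _ hpos
  have hv0 : v x₀ = 0 := (hmax.isLocalMax (Icc_mem_nhds hxI.1 hxI.2)).hasDerivAt_eq_zero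
    (huv.hasDerivAt_of_isPrimitiveOn hvf hf.neg hxI)
  have hxm : x₀ ∈ uIcc a b := by rwa [uIcc_of_le hab.le]
  have hhl : IntervalIntegrable h volume a x₀ := hh.mono_set (uIcc_subset_uIcc_left hxm)
  have hhr : IntervalIntegrable h volume x₀ b := hh.mono_set (uIcc_subset_uIcc_right hxm)
  set Z := u x₀ ^ (1 + γ) / (1 + γ) with hZ
  have hL : Z ≤ (x₀ - a) * ∫ t in a..x₀, h t := by
    obtain ⟨c, hac, hcx, hc0, hcpos⟩ := exists_zero_left hx₀.1
      (hu.mono (Icc_subset_Icc_right hx₀.2)) hua hpos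
    have hcm : c ∈ uIcc a x₀ := by rw [uIcc_of_le hx₀.1]; exact ⟨hac, hcx.le⟩
    have hhc : IntervalIntegrable h volume c x₀ := hhl.mono_set (uIcc_subset_uIcc_right hcm)
    have hlin : IntervalIntegrable (fun t => h t * (t - c)) volume c x₀ :=
      hhc.mul_continuousOn (by fun_prop)
    have := rpow_le_integral_left hac hcx hxI.2 (hu.mono (Icc_subset_Icc hac hx₀.2)) huv hvf hf hγ
      hc0 hcpos (fun x hx => hfh x ⟨hac.trans_lt hx.1, hx.2.trans_lt hxI.2⟩ (hcpos x hx)) hlin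
    rw [hv0, zero_mul, sub_zero] at this
    calc Z ≤ ∫ t in c..x₀, h t * (t - c) := this
      _ ≤ ∫ t in c..x₀, h t * (x₀ - a) :=
          intervalIntegral.integral_mono_on hcx.le hlin (hhc.mul_const _) fun t ht =>
            mul_le_mul_of_nonneg_left (by linarith [ht.2]) (hh0 t)
      _ = (x₀ - a) * ∫ t in c..x₀, h t := by
          rw [intervalIntegral.integral_mul_const, mul_comm]
      _ ≤ (x₀ - a) * ∫ t in a..x₀, h t := by
          refine mul_le_mul_of_nonneg_left ?_ (by linarith [hx₀.1])
          exact intervalIntegral.integral_mono_interval hac hcx.le le_rfl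
            (ae_of_all _ hh0) hhl
  have hR : Z ≤ (b - x₀) * ∫ t in x₀..b, h t := by
    obtain ⟨d, hdb, hxd, hd0, hdpos⟩ := exists_zero_right hx₀.2
      (hu.mono (Icc_subset_Icc_left hx₀.1)) hub hpos
    have hdm : d ∈ uIcc x₀ b := by rw [uIcc_of_le hx₀.2]; exact ⟨hxd.le, hdb⟩
    have hhd : IntervalIntegrable h volume x₀ d := hhr.mono_set (uIcc_subset_uIcc_left hdm)
    have hlin : IntervalIntegrable (fun t => h t * (d - t)) volume x₀ d :=
      hhd.mul_continuousOn (by fun_prop)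
    have := rpow_le_integral_right hdb hxd hxI.1 (hu.mono (Icc_subset_Icc hx₀.1 hdb)) huv hvf hf hγ
      hd0 hdpos (fun x hx => hfh x ⟨hxI.1.trans_le hx.1, hx.2.trans_le hdb⟩ (hdpos x hx)) hlin
    rw [hv0, zero_mul, add_zero] at this
    calc Z ≤ ∫ t in x₀..d, h t * (d - t) := this
      _ ≤ ∫ t in x₀..d, h t * (b - x₀) :=
          intervalIntegral.integral_mono_on hxd.le hlin (hhd.mul_const _) fun t ht =>
            mul_le_mul_of_nonneg_left (by linarith [ht.1]) (hh0 t)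
      _ = (b - x₀) * ∫ t in x₀..d, h t := by
          rw [intervalIntegral.integral_mul_const, mul_comm]
      _ ≤ (b - x₀) * ∫ t in x₀..b, h t := by
          refine mul_le_mul_of_nonneg_left ?_ (by linarith [hx₀.2])
          exact intervalIntegral.integral_mono_interval le_rfl hxd.le hdb
            (ae_of_all _ hh0) hhr
  have hsum := intervalIntegral.integral_add_adjacent_intervals hhl hhr
  set M := ∫ t in a..b, h t with hM
  have hM0 : 0 ≤ M := intervalIntegral.integral_nonneg hab.le fun t _ => hh0 t
  have h1 : 0 < x₀ - a := by linarith [hxI.1]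
  have h2 : 0 < b - x₀ := by linarith [hxI.2]
  -- The left bound is weighted by b - x₀ and the right one by x₀ - a, so that the two partial
  -- integrals of h add up to M; then (x₀ - a)(b - x₀) ≤ (b - a)²/4.
  have h3 : Z * (b - a) ≤ (b - a) / 4 * M * (b - a) := by
    have e1 := mul_le_mul_of_nonneg_left hL h2.le
    have e2 := mul_le_mul_of_nonneg_left hR h1.le
    have e3 : Z * (b - a) ≤ (x₀ - a) * (b - x₀) * M := by rw [← hsum]; linarith
    have e4 : (x₀ - a) * (b - x₀) ≤ (b - a) ^ 2 / 4 := by nlinarith [sq_nonneg (2 * x₀ - a - b)]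
    have e5 := mul_le_mul_of_nonneg_right e4 hM0
    linarith
  have h4 : Z ≤ (b - a) / 4 * M := le_of_mul_le_mul_right h3 (by linarith)
  have h5 : S ^ (1 + γ) < u x₀ ^ (1 + γ) := Real.rpow_lt_rpow hS hlt (by linarith)
  have h6 : u x₀ ^ (1 + γ) = (1 + γ) * Z := by rw [hZ]; field_simp
  have h7 := mul_le_mul_of_nonneg_left h4 (by linarith : 0 ≤ 1 + γ)
  linarith

/-! ### The lower barrier, and existence between the barriers -/

theorem intervalIntegral_eq_integral_volOn {a b : ℝ} (hab : a < b) (f : ℝ → ℝ) :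
    ∫ t in a..b, f t = ∫ t, f t ∂volOn a b := by
  rw [intervalIntegral.integral_of_le hab.le, integral_Ioc_eq_integral_Ioo, volOn]

theorem green_self_left {a b : ℝ} {t : ℝ} (ht : t ∈ Ioo a b) : green a b a t = 0 := by
  rw [green, min_eq_left ht.1.le]; simp

theorem green_self_right {a b : ℝ} {t : ℝ} (ht : t ∈ Ioo a b) : green a b b t = 0 := by
  rw [green, max_eq_left ht.2.le]; simp

theorem integral_green_left (a b : ℝ) (f : ℝ → ℝ) :
    ∫ t, green a b a t * f t ∂volOn a b = 0 := by
  refine integral_eq_zero_of_ae ?_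
  filter_upwards [ae_mem_volOn a b] with t ht
  simp [green_self_left ht]

theorem integral_green_right (a b : ℝ) (f : ℝ → ℝ) :
    ∫ t, green a b b t * f t ∂volOn a b = 0 := by
  refine integral_eq_zero_of_ae ?_
  filter_upwards [ae_mem_volOn a b] with t ht
  simp [green_self_right ht]

theorem eq_posPart_sub_negPart (m : ℝ → ℝ) (t : ℝ) : m t = m⁺ t - m⁻ t := by
  conv_lhs => rw [← posPart_sub_negPart m]
  rfl

/-- Lower bound for a Green potential, from the behaviour of Green's function near the
endpoints. -/
theorem mul_endDist_le_integral_green {a b k γ P N : ℝ} (hab : a < b) (hP : 0 ≤ P) (hN : 0 ≤ N)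
    {g n f : ℝ → ℝ} (hg0 : ∀ t, 0 ≤ g t) (hn0 : ∀ t, 0 ≤ n t)
    (hg : Integrable (fun t => g t * endDist a b t) (volOn a b))
    (hna : Integrable (fun t => leftWeight a n t * endDist a b t ^ (-γ)) (volOn a b))
    (hnb : Integrable (fun t => rightWeight b n t * endDist a b t ^ (-γ)) (volOn a b))
    (hA : k * (b - a) + N * ∫ t, leftWeight a n t * endDist a b t ^ (-γ) ∂volOn a b ≤
      P * ∫ t, g t * endDist a b t ∂volOn a b)
    (hB : k * (b - a) + N * ∫ t, rightWeight b n t * endDist a b t ^ (-γ) ∂volOn a b ≤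
      P * ∫ t, g t * endDist a b t ∂volOn a b)
    (hf : ∀ t ∈ Ioo a b, P * g t - N * (n t * endDist a b t ^ (-γ)) ≤ f t)
    {x : ℝ} (hx : x ∈ Icc a b) (hfi : Integrable (fun t => green a b x t * f t) (volOn a b)) :
    k * endDist a b x ≤ ∫ t, green a b x t * f t ∂volOn a b := by
  have hba : 0 < b - a := by linarith
  have hdx := endDist_nonneg hx
  have main : ∀ W : ℝ → ℝ, Integrable (fun t => W t * endDist a b t ^ (-γ)) (volOn a b) →
      (∀ t ∈ Ioo a b, green a b x t * n t ≤ endDist a b x / (b - a) * W t) →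
      k * (b - a) + N * ∫ t, W t * endDist a b t ^ (-γ) ∂volOn a b ≤
        P * ∫ t, g t * endDist a b t ∂volOn a b →
      k * endDist a b x ≤ ∫ t, green a b x t * f t ∂volOn a b := by
    intro W hW hgW hkW
    have h1 : ∫ t, (endDist a b x / (b - a) * P * (g t * endDist a b t) -
        endDist a b x / (b - a) * N * (W t * endDist a b t ^ (-γ))) ∂volOn a b ≤
        ∫ t, green a b x t * f t ∂volOn a b := by
      refine integral_mono_ae ((hg.const_mul _).sub (hW.const_mul _)) hfi ?_
      filter_upwards [ae_mem_volOn a b] with t ht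
      have ht' := Ioo_subset_Icc_self ht
      have hdt : 0 ≤ endDist a b t ^ (-γ) := Real.rpow_nonneg (endDist_pos ht).le _
      have e1 := mul_le_mul_of_nonneg_left (hf t ht) (green_nonneg hab hx ht')
      have e2 := mul_le_mul_of_nonneg_right (endDist_mul_endDist_le_green hab hx ht')
        (mul_nonneg hP (hg0 t))
      have e3 := mul_le_mul_of_nonneg_right (hgW t ht) (mul_nonneg hN hdt)
      have e4 : endDist a b x * endDist a b t / (b - a) * (P * g t) =
        endDist a b x / (b - a) * P * (g t * endDist a b t) := by ring
      linarith
    rw [integral_sub (hg.const_mul _) (hW.const_mul _), integral_const_mul,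
      integral_const_mul] at h1
    have h2 := mul_le_mul_of_nonneg_left hkW (div_nonneg hdx hba.le)
    have h3 : endDist a b x / (b - a) * (k * (b - a)) = k * endDist a b x := by
      field_simp
    linarith
  -- The endpoint nearer to x decides which upper bound on Green's function produces the factor
  -- δ(x), and so which of the two weights enters.
  rcases le_total (x - a) (b - x) with h | h
  · refine main _ hnb (fun t ht => ?_) hB
    have := mul_le_mul_of_nonneg_right (green_le_right_mul hab hx (Ioo_subset_Icc_self ht)) (hn0 t)
    rw [endDist, min_eq_left h, rightWeight]
    calc _ ≤ _ := this
      _ = _ := by ring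
  · refine main _ hna (fun t ht => ?_) hA
    have := mul_le_mul_of_nonneg_right (green_le_left_mul hab hx (Ioo_subset_Icc_self ht)) (hn0 t)
    rw [endDist, min_eq_right h, leftWeight]
    calc _ ≤ _ := this
      _ = _ := by ring

theorem integrable_green_mul {a b : ℝ} (hab : a < b) {f : ℝ → ℝ}
    (hfm : AEStronglyMeasurable f (volOn a b))
    (hd : Integrable (fun t => endDist a b t * f t) (volOn a b)) {x : ℝ} (hx : x ∈ Icc a b) :
    Integrable (fun t => green a b x t * f t) (volOn a b) := by
  refine hd.norm.mono' ((continuous_green_right a b x).aestronglyMeasurable.mul hfm) ?_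
  filter_upwards [ae_mem_volOn a b] with t ht
  have ht' := Ioo_subset_Icc_self ht
  rw [norm_mul, norm_mul, Real.norm_of_nonneg (endDist_pos ht).le,
    Real.norm_of_nonneg (green_nonneg hab hx ht')]
  exact mul_le_mul_of_nonneg_right (green_le_endDist hab hx ht') (norm_nonneg _)

theorem locallyIntegrableOn_of_integrable_volOn {a b : ℝ} {m : ℝ → ℝ}
    (hm : Integrable m (volOn a b)) : LocallyIntegrableOn m (Ioo a b) :=
  IntegrableOn.locallyIntegrableOn hm

theorem integrable_endDist_mul_of_le {a b k γ : ℝ} (hk : 0 < k) (hγ : 0 < γ) (hγ1 : γ < 1)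
    {m u : ℝ → ℝ} (hm : Integrable m (volOn a b)) (hu : ContinuousOn u (Ioo a b))
    (hku : ∀ x ∈ Ioo a b, k * endDist a b x ≤ u x) :
    LocallyIntegrableOn (fun t => m t * u t ^ (-γ)) (Ioo a b) ∧
      Integrable (fun t => endDist a b t * (m t * u t ^ (-γ))) (volOn a b) := by
  have hpos : ∀ t ∈ Ioo a b, 0 < u t := fun t ht =>
    (mul_pos hk (endDist_pos ht)).trans_le (hku t ht)
  have hl := locallyIntegrableOn_mul_of_continuousOn (locallyIntegrableOn_of_integrable_volOn hm)
    (hu.rpow_const (p := -γ) fun t ht => Or.inl (hpos t ht).ne')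
  refine ⟨hl, (integrable_endDist_mul hk hγ1 hm).mono'
    ((continuous_endDist a b).aestronglyMeasurable.mul hl.aestronglyMeasurable) ?_⟩
  filter_upwards [ae_mem_volOn a b] with t ht
  have hd := endDist_pos ht
  rw [norm_mul, norm_mul, Real.norm_of_nonneg hd.le,
    Real.norm_of_nonneg (Real.rpow_nonneg (hpos t ht).le _), Real.norm_eq_abs]
  exact mul_le_mul_of_nonneg_left (mul_le_mul_of_nonneg_left
    (Real.rpow_le_rpow_of_nonpos (mul_pos hk hd) (hku t ht) (by linarith)) (abs_nonneg _)) hd.le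

/-- Existence of a solution between `k` times the distance to the boundary and the constant
`S`. -/
theorem exists_green_solution {a b k S γ : ℝ} (hab : a < b) (hγ : 0 < γ) (hγ1 : γ < 1)
    (hk : 0 < k) (hkS : k * ((b - a) / 2) ≤ S) {m : ℝ → ℝ} (hm : Integrable m (volOn a b))
    (hM : (1 + γ) * ((b - a) / 4 * ∫ t in a..b, m⁺ t) ≤ S ^ (1 + γ))
    (hna : Integrable (fun t => leftWeight a m⁻ t * endDist a b t ^ (-γ)) (volOn a b))
    (hnb : Integrable (fun t => rightWeight b m⁻ t * endDist a b t ^ (-γ)) (volOn a b))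
    (hA : k * (b - a) + k ^ (-γ) * ∫ t, leftWeight a m⁻ t * endDist a b t ^ (-γ) ∂volOn a b ≤
      S ^ (-γ) * ∫ t, m⁺ t * endDist a b t ∂volOn a b)
    (hB : k * (b - a) + k ^ (-γ) * ∫ t, rightWeight b m⁻ t * endDist a b t ^ (-γ) ∂volOn a b ≤
      S ^ (-γ) * ∫ t, m⁺ t * endDist a b t ∂volOn a b) :
    ∃ u : ℝ → ℝ, Continuous u ∧ (∀ x ∈ Icc a b, k * endDist a b x ≤ u x) ∧
      ∀ x ∈ Icc a b, u x = ∫ t, green a b x t * (m t * u t ^ (-γ)) ∂volOn a b := by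
  have hba : 0 < b - a := by linarith
  have hS : 0 < S := lt_of_lt_of_le (by positivity) hkS
  have hp0 : ∀ t, 0 ≤ m⁺ t := fun t => by
    rw [Pi.posPart_apply]; exact posPart_nonneg _
  have hn0 : ∀ t, 0 ≤ m⁻ t := fun t => by
    rw [Pi.negPart_apply]; exact negPart_nonneg _
  have hmp : Integrable m⁺ (volOn a b) := hm.pos_part
  obtain ⟨u, huc, hu⟩ := exists_truncated_solution hab hk hγ hγ1 hm
  -- Where u > 0, w ≥ u gives m w^(-γ) u^γ ≤ m⁺, so the upper bound applies to u without any prior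
  -- lower bound on it.
  set w : ℝ → ℝ := fun t => max (u t) (k * endDist a b t) with hw
  have hwc : Continuous w := huc.max (continuous_const.mul (continuous_endDist a b))
  have hwk : ∀ t, k * endDist a b t ≤ w t := fun t => le_max_right _ _
  obtain ⟨hfl, hdf⟩ := integrable_endDist_mul_of_le hk hγ hγ1 hm hwc.continuousOn
    (fun x _ => hwk x)
  have hwpos : ∀ t ∈ Ioo a b, 0 < w t := fun t ht =>
    (mul_pos hk (endDist_pos ht)).trans_le (hwk t)
  obtain ⟨huv, hvf⟩ := isPrimitiveOn_green hab hfl hdf hu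
  have hua : u a = 0 := by rw [hu a (left_mem_Icc.2 hab.le), integral_green_left]
  have hub : u b = 0 := by rw [hu b (right_mem_Icc.2 hab.le), integral_green_right]
  have huS := rpow_le_of_mul_rpow_le hab hγ huc.continuousOn hua hub huv hvf hfl hp0
    ((intervalIntegrable_iff_integrableOn_Ioo_of_le hab.le).2 hmp) (fun t ht hut => by
      have h1 : 0 ≤ w t ^ (-γ) := Real.rpow_nonneg (hwpos t ht).le _
      have h2 : w t ^ (-γ) * u t ^ γ ≤ 1 := by
        have h3 : w t ^ (-γ) ≤ u t ^ (-γ) :=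
          Real.rpow_le_rpow_of_nonpos hut (le_max_left _ _) (by linarith)
        have h4 : u t ^ (-γ) * u t ^ γ = 1 := by rw [← Real.rpow_add hut]; simp
        rw [← h4]
        exact mul_le_mul_of_nonneg_right h3 (Real.rpow_nonneg hut.le _)
      have h5 : 0 ≤ w t ^ (-γ) * u t ^ γ := mul_nonneg h1 (Real.rpow_nonneg hut.le _)
      have h6 := eq_posPart_sub_negPart m t
      calc m t * w t ^ (-γ) * u t ^ γ = m t * (w t ^ (-γ) * u t ^ γ) := by ring
        _ ≤ m⁺ t * (w t ^ (-γ) * u t ^ γ) :=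
            mul_le_mul_of_nonneg_right (by linarith [hn0 t]) h5
        _ ≤ m⁺ t := mul_le_of_le_one_right (hp0 t) h2) hS.le hM
  have hwS : ∀ t ∈ Icc a b, w t ≤ S := fun t ht => max_le (huS t ht)
    ((mul_le_mul_of_nonneg_left (endDist_le t) hk.le).trans hkS)
  have hgi : Integrable (fun t => m⁺ t * endDist a b t) (volOn a b) := by
    refine hmp.mul_bdd (c := b - a) (continuous_endDist a b).aestronglyMeasurable ?_
    filter_upwards [ae_mem_volOn a b] with t ht
    rw [Real.norm_of_nonneg (endDist_pos ht).le]
    linarith [endDist_le (a := a) (b := b) t]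
  -- From kδ ≤ w ≤ S, the right-hand side m w^(-γ) is at least S^(-γ) m⁺ - k^(-γ) m⁻ δ^(-γ), which
  -- is the input of the Green estimate.
  have hlow : ∀ x ∈ Icc a b, k * endDist a b x ≤ u x := fun x hx => by
    rw [hu x hx]
    refine mul_endDist_le_integral_green hab (Real.rpow_nonneg hS.le (-γ))
      (Real.rpow_nonneg hk.le (-γ)) hp0 hn0 hgi hna hnb hA hB (fun t ht => ?_) hx
      (integrable_green_mul hab hfl.aestronglyMeasurable hdf hx)
    have hd := endDist_pos ht
    have h1 : S ^ (-γ) ≤ w t ^ (-γ) := Real.rpow_le_rpow_of_nonpos (hwpos t ht)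
      (hwS t (Ioo_subset_Icc_self ht)) (by linarith)
    have h2 : w t ^ (-γ) ≤ k ^ (-γ) * endDist a b t ^ (-γ) := by
      rw [← Real.mul_rpow hk.le hd.le]
      exact Real.rpow_le_rpow_of_nonpos (mul_pos hk hd) (hwk t) (by linarith)
    have e1 := mul_le_mul_of_nonneg_right h1 (hp0 t)
    have e2 := mul_le_mul_of_nonneg_right h2 (hn0 t)
    have e3 : m t * w t ^ (-γ) = w t ^ (-γ) * m⁺ t - w t ^ (-γ) * m⁻ t := by
      rw [eq_posPart_sub_negPart m t]; ring
    change _ ≤ m t * w t ^ (-γ)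
    rw [e3]
    linarith
  refine ⟨u, huc, hlow, fun x hx => (hu x hx).trans (integral_congr_ae ?_)⟩
  filter_upwards [ae_mem_volOn a b] with t ht
  rw [max_eq_left (hlow t (Ioo_subset_Icc_self ht))]

/-! ### Regularity and the interior of the cone -/

theorem memLp_restrict_of_continuousOn {C : Set ℝ} (hC : IsCompact C) {v : ℝ → ℝ}
    (hv : ContinuousOn v C) (p : ℝ≥0∞) : MemLp v p (volume.restrict C) := by
  have : IsFiniteMeasure (volume.restrict C) := isFiniteMeasure_restrict.2 hC.measure_lt_top.ne
  obtain ⟨R, hR⟩ := hC.exists_bound_of_continuousOn hv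
  exact MemLp.of_bound (hv.aestronglyMeasurable hC.measurableSet) R
    ((ae_restrict_iff' hC.measurableSet).2 (ae_of_all _ hR))

theorem IsPrimitiveOn.contDiffOn_one {a b : ℝ} {u v : ℝ → ℝ} (h : IsPrimitiveOn a b u v)
    (hv : ContinuousOn v (Ioo a b)) : ContDiffOn ℝ 1 u (Ioo a b) := by
  rw [contDiffOn_one_iff_derivWithin (uniqueDiffOn_Ioo a b)]
  refine ⟨fun x hx => (h.hasDerivAt hv hx).differentiableAt.differentiableWithinAt,
    hv.congr fun x hx => ?_⟩
  exact (h.hasDerivAt hv hx).hasDerivWithinAt.derivWithin (uniqueDiffOn_Ioo a b x hx)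

/-- A positive function with absolutely continuous derivative such that `-u'' = m u ^ (-γ)` is a
solution. -/
theorem isSingularSolution_of_isPrimitiveOn {a b γ : ℝ} (hab : a < b) {m u v : ℝ → ℝ}
    (hu : ContinuousOn u (Icc a b)) (hpos : ∀ x ∈ Ioo a b, 0 < u x) (hua : u a = 0)
    (hub : u b = 0) (hf : LocallyIntegrableOn (fun t => m t * u t ^ (-γ)) (Ioo a b))
    (huv : IsPrimitiveOn a b u v) (hvf : IsPrimitiveOn a b v (-fun t => m t * u t ^ (-γ))) :
    IsSingularSolution a b m γ u := by
  have hvc := hvf.continuousOn hf.neg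
  refine ⟨hu, hpos, hua, hub, v,
    huv.hasWeakDerivOn hab (hvc.locallyIntegrableOn measurableSet_Ioo),
    fun C hC hCs => memLp_restrict_of_continuousOn hC (hvc.mono hCs) 2, fun φ hφ => ?_⟩
  rw [hvf.integral_mul_deriv_test hab hf.neg hφ, ← integral_neg]
  refine integral_congr_ae (ae_of_all _ fun x => ?_)
  simp only [Pi.neg_apply]
  ring

/-- With an integrable right-hand side, the solution is of class `C^1` up to the boundary. -/
theorem contDiffOn_Icc_of_isPrimitiveOn {a b : ℝ} (hab : a < b) {u v f : ℝ → ℝ}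
    (hu : ContinuousOn u (Icc a b)) (hf : Integrable f (volOn a b))
    (huv : IsPrimitiveOn a b u v) (hvf : IsPrimitiveOn a b v f) :
    ContDiffOn ℝ 1 u (Icc a b) := by
  set c := (a + b) / 2 with hc
  have hcI : c ∈ Ioo a b := ⟨by rw [hc]; linarith, by rw [hc]; linarith⟩
  -- Extension by zero produces a C¹ function U on the whole line that agrees with u on (a, b),
  -- hence on [a, b] by continuity.
  set F : ℝ → ℝ := (Ioo a b).indicator f with hF
  have hFi : Integrable F := (integrable_indicator_iff measurableSet_Ioo).2 hf
  set V : ℝ → ℝ := fun x => v c + ∫ t in c..x, F t with hV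
  have hVc : Continuous V := continuous_const.add
    (intervalIntegral.continuous_primitive (fun _ _ => hFi.intervalIntegrable) c)
  have hVv : ∀ x ∈ Ioo a b, V x = v x := fun x hx => by
    have h1 : ∫ t in c..x, F t = ∫ t in c..x, f t := by
      refine intervalIntegral.integral_congr fun t ht => ?_
      exact indicator_of_mem (ordConnected_Ioo.uIcc_subset hcI hx ht) f
    have := hvf c hcI x hx
    rw [hV]
    simp only
    rw [h1]; linarith
  set U : ℝ → ℝ := fun x => u c + ∫ t in c..x, V t with hU
  have hUd : ∀ x, HasDerivAt U (V x) x := fun x =>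
    (intervalIntegral.integral_hasDerivAt_right (hVc.intervalIntegrable _ _)
      (hVc.stronglyMeasurableAtFilter _ _) hVc.continuousAt).const_add _
  have hUu : EqOn U u (Ioo a b) := fun x hx => by
    have h1 : ∫ t in c..x, V t = ∫ t in c..x, v t :=
      intervalIntegral.integral_congr fun t ht =>
        hVv t (ordConnected_Ioo.uIcc_subset hcI hx ht)
    have := huv c hcI x hx
    rw [hU]
    simp only
    rw [h1]; linarith
  have hUc : Continuous U := continuous_iff_continuousAt.2 fun x => (hUd x).continuousAt
  have hUu' : EqOn U u (Icc a b) :=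
    hUu.of_subset_closure hUc.continuousOn hu Ioo_subset_Icc_self
      (by rw [closure_Ioo hab.ne])
  have hUC : ContDiff ℝ 1 U := by
    rw [contDiff_one_iff_deriv]
    refine ⟨fun x => (hUd x).differentiableAt, ?_⟩
    rwa [show deriv U = V from funext fun x => (hUd x).deriv]
  exact hUC.contDiffOn.congr fun x hx => (hUu' hx).symm

/-- The radius k suffices: if |w' - u'| < k and w - u vanishes at both ends, the mean value
inequality from either end gives |w - u| ≤ kδ ≤ u. -/
theorem memConeInterior_of_mul_endDist_le {a b k : ℝ} (hab : a < b) (hk : 0 < k) {u : ℝ → ℝ}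
    (hu : MemC10 a b u) (hku : ∀ x ∈ Icc a b, k * endDist a b x ≤ u x) :
    MemConeInterior a b u := by
  refine ⟨hu, k, hk, fun w hw hclose x hx => ?_⟩
  have hud : DifferentiableOn ℝ u (Icc a b) := hu.1.differentiableOn (by simp)
  have hwd : DifferentiableOn ℝ w (Icc a b) := hw.1.differentiableOn (by simp)
  have hbound : ∀ y ∈ Icc a b, ∀ z ∈ Icc a b, |(w z - u z) - (w y - u y)| ≤ k * |z - y| := by
    intro y hy z hz
    have := Convex.norm_image_sub_le_of_norm_hasDerivWithin_le (s := Icc a b)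
      (f := fun x => w x - u x)
      (f' := fun x => derivWithin w (Icc a b) x - derivWithin u (Icc a b) x) (C := k)
      (fun x hx => (hwd x hx).hasDerivWithinAt.sub (hud x hx).hasDerivWithinAt)
      (fun x hx => (hclose x hx).2.le) (convex_Icc a b) hy hz
    simpa only [Real.norm_eq_abs] using this
  have h1 := hbound a (left_mem_Icc.2 hab.le) x hx
  have h2 := hbound b (right_mem_Icc.2 hab.le) x hx
  rw [hw.2.1, hu.2.1, sub_self, sub_zero, abs_of_nonneg (by linarith [hx.1] : 0 ≤ x - a)] at h1
  rw [hw.2.2, hu.2.2, sub_self, sub_zero, abs_of_nonpos (by linarith [hx.2] : x - b ≤ 0)] at h2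
  have h3 := hku x hx
  have h4 := (abs_le.1 h1).1
  have h5 := (abs_le.1 h2).1
  rcases le_total (x - a) (b - x) with h | h
  · rw [endDist, min_eq_left h] at h3
    linarith
  · rw [endDist, min_eq_right h] at h3
    linarith

/-- Sobolev regularity of a Green potential of a function of `L^q`. -/
theorem memW2_of_green {a b : ℝ} (hab : a < b) {u f : ℝ → ℝ} {q : ℝ≥0∞} (hq : 1 ≤ q)
    (hu : ContinuousOn u (Icc a b)) (hf : MemLp f q (volOn a b))
    (huv : IsPrimitiveOn a b u (fun x => ∫ t, dgreen a b x t * f t ∂volOn a b))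
    (hvf : IsPrimitiveOn a b (fun x => ∫ t, dgreen a b x t * f t ∂volOn a b) (-f)) :
    MemW2 a b q u := by
  have hfi : Integrable f (volOn a b) := hf.integrable hq
  have hfl := locallyIntegrableOn_of_integrable_volOn hfi
  have hvc := hvf.continuousOn hfl.neg
  refine ⟨?_, _, -f, huv.hasWeakDerivOn hab (hvc.locallyIntegrableOn measurableSet_Ioo),
    hvf.hasWeakDerivOn hab hfl.neg, ?_, hf.neg⟩
  · exact (memLp_restrict_of_continuousOn isCompact_Icc hu q).mono_measure
      (Measure.restrict_mono Ioo_subset_Icc_self le_rfl)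
  · refine MemLp.of_bound (hvc.aestronglyMeasurable measurableSet_Ioo)
      (∫ t, |f t| ∂volOn a b) (ae_of_all _ fun x => norm_integral_le_of_norm_le hfi.abs ?_)
    filter_upwards [ae_mem_volOn a b] with t ht
    rw [norm_mul]
    exact mul_le_of_le_one_left (norm_nonneg _) (abs_dgreen_le_one ht)

/-- Solutions given by Green's function that are bounded below by a multiple of the distance to
the boundary, and their regularity. -/
theorem green_solution_regularity {a b k γ : ℝ} (hab : a < b) (hγ : 0 < γ) (hγ1 : γ < 1)
    (hk : 0 < k) {m u : ℝ → ℝ} (hm : Integrable m (volOn a b)) (huc : Continuous u)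
    (hku : ∀ x ∈ Icc a b, k * endDist a b x ≤ u x)
    (hu : ∀ x ∈ Icc a b, u x = ∫ t, green a b x t * (m t * u t ^ (-γ)) ∂volOn a b) :
    IsSingularSolution a b m γ u ∧ ContDiffOn ℝ 1 u (Ioo a b) ∧
      ∀ q : ℝ≥0∞, 1 ≤ q → MemLp (fun t => m t * endDist a b t ^ (-γ)) q (volOn a b) →
        MemW2 a b q u ∧ MemConeInterior a b u := by
  have hku' : ∀ x ∈ Ioo a b, k * endDist a b x ≤ u x := fun x hx =>
    hku x (Ioo_subset_Icc_self hx)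
  have hpos : ∀ t ∈ Ioo a b, 0 < u t := fun t ht =>
    (mul_pos hk (endDist_pos ht)).trans_le (hku' t ht)
  obtain ⟨hfl, hdf⟩ := integrable_endDist_mul_of_le hk hγ hγ1 hm huc.continuousOn hku'
  obtain ⟨huv, hvf⟩ := isPrimitiveOn_green hab hfl hdf hu
  have hua : u a = 0 := by rw [hu a (left_mem_Icc.2 hab.le), integral_green_left]
  have hub : u b = 0 := by rw [hu b (right_mem_Icc.2 hab.le), integral_green_right]
  refine ⟨isSingularSolution_of_isPrimitiveOn hab huc.continuousOn hpos hua hub hfl huv hvf,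
    huv.contDiffOn_one (hvf.continuousOn hfl.neg), fun q hq hmq => ?_⟩
  have hfq : MemLp (fun t => m t * u t ^ (-γ)) q (volOn a b) := by
    refine (hmq.const_mul (k ^ (-γ))).mono hfl.aestronglyMeasurable ?_
    filter_upwards [ae_mem_volOn a b] with t ht
    have hd := endDist_pos ht
    have h1 : u t ^ (-γ) ≤ k ^ (-γ) * endDist a b t ^ (-γ) := by
      rw [← Real.mul_rpow hk.le hd.le]
      exact Real.rpow_le_rpow_of_nonpos (mul_pos hk hd) (hku' t ht) (by linarith)
    rw [norm_mul, norm_mul, norm_mul, Real.norm_of_nonneg (Real.rpow_nonneg (hpos t ht).le _),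
      Real.norm_of_nonneg (Real.rpow_nonneg hk.le _),
      Real.norm_of_nonneg (Real.rpow_nonneg hd.le _)]
    calc _ ≤ ‖m t‖ * (k ^ (-γ) * endDist a b t ^ (-γ)) :=
          mul_le_mul_of_nonneg_left h1 (norm_nonneg _)
      _ = _ := by ring
  exact ⟨memW2_of_green hab hq huc.continuousOn hfq huv hvf,
    memConeInterior_of_mul_endDist_le hab hk
      ⟨contDiffOn_Icc_of_isPrimitiveOn hab huc.continuousOn (hfq.integrable hq).neg huv hvf,
        hua, hub⟩ hku⟩

/-! ### Negative powers of the distance and Hölder's inequality -/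

theorem integrable_endDist_rpow {a b s : ℝ} (hab : a < b) (hs : s < 1) :
    Integrable (fun t => endDist a b t ^ (-s)) (volOn a b) ∧
      ∫ t, endDist a b t ^ (-s) ∂volOn a b = 2 * ((b - a) / 2) ^ (1 - s) / (1 - s) := by
  set c := (a + b) / 2 with hc
  have hac : a ≤ c := by rw [hc]; linarith
  have hcb : c ≤ b := by rw [hc]; linarith
  have hℓ : c - a = (b - a) / 2 := by rw [hc]; ring
  have hℓ' : b - c = (b - a) / 2 := by rw [hc]; ring
  have hbase : ∀ x y : ℝ, IntervalIntegrable (fun t : ℝ => t ^ (-s)) volume x y := fun x y =>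
    intervalIntegral.intervalIntegrable_rpow' (by linarith)
  have e1 : EqOn (fun t => (t - a) ^ (-s)) (fun t => endDist a b t ^ (-s)) (uIcc a c) :=
    fun t ht => by
      rw [uIcc_of_le hac] at ht
      simp only [endDist]
      rw [min_eq_left (by linarith [ht.2])]
  have e2 : EqOn (fun t => (b - t) ^ (-s)) (fun t => endDist a b t ^ (-s)) (uIcc c b) :=
    fun t ht => by
      rw [uIcc_of_le hcb] at ht
      simp only [endDist]
      rw [min_eq_right (by linarith [ht.1])]
  have i1 : IntervalIntegrable (fun t => endDist a b t ^ (-s)) volume a c := by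
    have := (hbase 0 (c - a)).comp_sub_right a
    rw [zero_add, sub_add_cancel] at this
    exact this.congr (e1.mono uIoc_subset_uIcc)
  have i2 : IntervalIntegrable (fun t => endDist a b t ^ (-s)) volume c b := by
    have := (hbase (b - c) 0).comp_sub_left b
    rw [sub_zero, sub_sub_cancel] at this
    exact this.congr (e2.mono uIoc_subset_uIcc)
  have hval : ∫ t in (0 : ℝ)..((b - a) / 2), t ^ (-s) = ((b - a) / 2) ^ (1 - s) / (1 - s) := by
    rw [integral_rpow (Or.inl (by linarith)), show -s + 1 = 1 - s by ring,
      Real.zero_rpow (by linarith), sub_zero]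
  refine ⟨(intervalIntegrable_iff_integrableOn_Ioo_of_le hab.le).1 (i1.trans i2), ?_⟩
  rw [← intervalIntegral_eq_integral_volOn hab,
    ← intervalIntegral.integral_add_adjacent_intervals i1 i2,
    ← intervalIntegral.integral_congr e1, ← intervalIntegral.integral_congr e2,
    intervalIntegral.integral_comp_sub_right (fun t => t ^ (-s)),
    intervalIntegral.integral_comp_sub_left (fun t => t ^ (-s)), sub_self, sub_self, hℓ, hℓ', hval]
  ring

theorem aestronglyMeasurable_endDist_rpow (a b s : ℝ) :
    AEStronglyMeasurable (fun t => endDist a b t ^ s) (volOn a b) :=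
  ((continuous_endDist a b).measurable.pow_const s).aestronglyMeasurable

theorem norm_endDist_rpow_rpow (a b γ r : ℝ) :
    (fun t => ‖endDist a b t ^ (-γ)‖ ^ r) =ᵐ[volOn a b] fun t => endDist a b t ^ (-(γ * r)) := by
  filter_upwards [ae_mem_volOn a b] with t ht
  have hd := (endDist_pos ht).le
  rw [Real.norm_of_nonneg (Real.rpow_nonneg hd _), ← Real.rpow_mul hd, neg_mul]

theorem memLp_endDist_rpow {a b γ : ℝ} (hab : a < b) {q : ℝ≥0∞} (hq0 : q ≠ 0) (hq : q ≠ ⊤)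
    (hγ : γ * q.toReal < 1) : MemLp (fun t => endDist a b t ^ (-γ)) q (volOn a b) := by
  rw [← integrable_norm_rpow_iff (aestronglyMeasurable_endDist_rpow a b _) hq0 hq]
  exact (integrable_endDist_rpow hab hγ).1.congr (norm_endDist_rpow_rpow a b γ _).symm

theorem eLpNorm_endDist_rpow {a b γ : ℝ} (hab : a < b) {q : ℝ≥0∞} (hq0 : q ≠ 0) (hq : q ≠ ⊤)
    (hγ : γ * q.toReal < 1) : eLpNorm (fun t => endDist a b t ^ (-γ)) q (volOn a b) =
      ENNReal.ofReal ((2 * ((b - a) / 2) ^ (1 - γ * q.toReal) / (1 - γ * q.toReal)) ^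
        q.toReal⁻¹) := by
  rw [(memLp_endDist_rpow hab hq0 hq hγ).eLpNorm_eq_integral_rpow_norm hq0 hq,
    integral_congr_ae (norm_endDist_rpow_rpow a b γ _), (integrable_endDist_rpow hab hγ).2]

/-- Hölder's inequality against a negative power of the distance to the boundary. -/
theorem integral_mul_endDist_rpow_le {a b γ : ℝ} (hab : a < b) {p q : ℝ≥0∞}
    [p.HolderConjugate q] (hq0 : q ≠ 0) (hq : q ≠ ⊤) (hγ : γ * q.toReal < 1) {W : ℝ → ℝ}
    (hW : MemLp W p (volOn a b)) :
    Integrable (fun t => W t * endDist a b t ^ (-γ)) (volOn a b) ∧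
      ∫ t, W t * endDist a b t ^ (-γ) ∂volOn a b ≤ lpNormOn a b p W *
        (2 * ((b - a) / 2) ^ (1 - γ * q.toReal) / (1 - γ * q.toReal)) ^ (1 / q.toReal) := by
  have hg := memLp_endDist_rpow hab hq0 hq hγ
  have hi : Integrable (fun t => W t * endDist a b t ^ (-γ)) (volOn a b) := hW.integrable_mul hg
  refine ⟨hi, ?_⟩
  have hH := eLpNorm_smul_le_mul_eLpNorm (p := p) (q := q) (r := 1) hg.1 hW.1
  rw [eLpNorm_endDist_rpow hab hq0 hq hγ] at hH
  have hpos : 0 ≤ (2 * ((b - a) / 2) ^ (1 - γ * q.toReal) / (1 - γ * q.toReal)) ^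
      q.toReal⁻¹ := by
    have : 0 < 1 - γ * q.toReal := by linarith
    have : 0 < b - a := by linarith
    positivity
  calc ∫ t, W t * endDist a b t ^ (-γ) ∂volOn a b
      ≤ ∫ t, ‖W t * endDist a b t ^ (-γ)‖ ∂volOn a b :=
        integral_mono hi hi.norm fun t => Real.le_norm_self _
    _ = (eLpNorm (W • fun t => endDist a b t ^ (-γ)) 1 (volOn a b)).toReal := by
        rw [integral_norm_eq_lintegral_enorm hi.1, eLpNorm_one_eq_lintegral_enorm]
        rfl
    _ ≤ _ := by
        refine (ENNReal.toReal_mono (ENNReal.mul_ne_top hW.2.ne ENNReal.ofReal_ne_top) hH).trans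
          (le_of_eq ?_)
        rw [ENNReal.toReal_mul, ENNReal.toReal_ofReal hpos, lpNormOn, one_div]

theorem conjExponent_toReal {p : ℝ≥0∞} (hp : 2 ≤ p) :
    ENNReal.conjExponent p ≠ 0 ∧ ENNReal.conjExponent p ≠ ⊤ ∧
      0 < (ENNReal.conjExponent p).toReal ∧
      1 / (ENNReal.conjExponent p).toReal = 1 - (p⁻¹).toReal := by
  have h1 : 1 ≤ p := le_trans (by norm_num) hp
  have := ENNReal.HolderConjugate.conjExponent h1
  have hsum := ENNReal.HolderConjugate.inv_add_inv_eq_one p (ENNReal.conjExponent p)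
  have h0 : ENNReal.conjExponent p ≠ 0 := by simp [ENNReal.conjExponent]
  have htop : ENNReal.conjExponent p ≠ ⊤ := by
    have h2 : p - 1 ≠ 0 := by
      rw [Ne, tsub_eq_zero_iff_le, not_le]
      exact lt_of_lt_of_le (by norm_num) hp
    simp [ENNReal.conjExponent, h2]
  have hpi : p⁻¹ ≠ ⊤ := by
    rw [Ne, ENNReal.inv_eq_top]; rintro rfl; simp at h1
  refine ⟨h0, htop, ENNReal.toReal_pos h0 htop, ?_⟩
  have h3 := congrArg ENNReal.toReal hsum
  rw [ENNReal.toReal_add hpi (ENNReal.inv_ne_top.2 h0), ENNReal.toReal_one,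
    ENNReal.toReal_inv (ENNReal.conjExponent p)] at h3
  rw [one_div]; linarith

/-- The strict inequality γ < 1 - 1/p leaves room in Hölder's inequality to land in a space strictly
better than L¹. -/
theorem exists_memLp_mul_endDist_rpow {a b γ : ℝ} (hab : a < b) (hγ : 0 < γ) {p : ℝ≥0∞}
    (hp : 2 ≤ p) (hγp : γ < 1 - (p⁻¹).toReal) {n : ℝ → ℝ} (hn : MemLp n p (volOn a b)) :
    ∃ s : ℝ≥0∞, 1 < s ∧ MemLp (fun t => n t * endDist a b t ^ (-γ)) s (volOn a b) := by
  -- With 1/q = τ, the inequality γ < τ puts δ^(-γ) in L^q, and τ < 1 - 1/p makes 1/p + 1/q < 1.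
  set τ := (γ + (1 - (p⁻¹).toReal)) / 2 with hτ
  have h0 : γ < τ := by rw [hτ]; linarith
  have h1 : τ < 1 - (p⁻¹).toReal := by rw [hτ]; linarith
  have hτ0 : 0 < τ := hγ.trans h0
  have hpi : p⁻¹ ≠ ⊤ := by
    rw [Ne, ENNReal.inv_eq_top]; rintro rfl; simp at hp
  set q : ℝ≥0∞ := (ENNReal.ofReal τ)⁻¹ with hq
  have hq0 : q ≠ 0 := ENNReal.inv_ne_zero.2 ENNReal.ofReal_ne_top
  have hqt : q ≠ ⊤ := ENNReal.inv_ne_top.2 (by simpa using hτ0)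
  have hqr : q.toReal = τ⁻¹ := by rw [hq, ENNReal.toReal_inv, ENNReal.toReal_ofReal hτ0.le]
  have hg := memLp_endDist_rpow hab hq0 hqt (γ := γ) (by
    rw [hqr, ← div_eq_mul_inv, div_lt_one hτ0]; exact h0)
  have hH : ENNReal.HolderTriple p q (p⁻¹ + q⁻¹)⁻¹ := ⟨(inv_inv _).symm⟩
  refine ⟨(p⁻¹ + q⁻¹)⁻¹, ?_, hg.mul hn⟩
  rw [ENNReal.one_lt_inv, hq, inv_inv, ← ENNReal.ofReal_toReal hpi,
    ← ENNReal.ofReal_add ENNReal.toReal_nonneg hτ0.le, ENNReal.ofReal_lt_one]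
  linarith

/-! ### Choice of the barriers and existence under the smallness condition -/

/-- The optimal choice of the barrier parameters. -/
theorem exists_barrier_parameters {γ ℓ M A B : ℝ} (hγ : 0 < γ) (hγ1 : γ < 1) (hℓ : 0 < ℓ)
    (hA : 0 < A) (hAM : A ≤ M * (ℓ / 2))
    (hB : B ≤ γ ^ γ / (γ + 1) ^ (γ + 1) * (2 / ℓ ^ 2) ^ γ * (A ^ (1 + γ) / M ^ γ)) :
    ∃ k S : ℝ, 0 < k ∧ k * (ℓ / 2) ≤ S ∧ (1 + γ) * (ℓ / 4 * M) ≤ S ^ (1 + γ) ∧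
      k * ℓ + k ^ (-γ) * B ≤ S ^ (-γ) * A := by
  have hM : 0 < M := pos_of_mul_pos_left (hA.trans_le hAM) (by positivity)
  have hg1 : 0 < 1 + γ := by linarith
  set Q := (1 + γ) * (ℓ / 4 * M) with hQ
  have hQ0 : 0 < Q := by positivity
  -- The smallest S allowed by the upper bound, which makes P = S^(-γ) largest.
  set S := Q ^ (1 / (1 + γ)) with hS
  have hS0 : 0 < S := by positivity
  have hSQ : S ^ (1 + γ) = Q := by
    rw [hS, ← Real.rpow_mul hQ0.le, one_div_mul_cancel hg1.ne', Real.rpow_one]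
  set P := S ^ (-γ) with hP
  have hP0 : 0 < P := by positivity
  have hPQ : P ^ (1 + γ) = Q ^ (-γ) := by
    rw [hP, ← Real.rpow_mul hS0.le, mul_comm, Real.rpow_mul hS0.le, hSQ]
  have hPS : P * Q = S := by
    rw [hP, ← hSQ, ← Real.rpow_add hS0]; simp
  -- The maximiser of k^γ (P A - k ℓ), the largest value of B that the last inequality tolerates;
  -- the maximum produces the factor γ^γ/(γ+1)^(γ+1).
  set k := γ * (P * A) / ((1 + γ) * ℓ) with hk
  have hk0 : 0 < k := by positivity
  have hkℓ : k * ℓ = γ / (1 + γ) * (P * A) := by rw [hk]; field_simp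
  refine ⟨k, S, hk0, ?_, hSQ.ge, ?_⟩
  · have h1 : k * (ℓ / 2) = γ / (1 + γ) * (P * A) / 2 := by rw [← hkℓ]; ring
    rw [h1]
    have h2 : P * A ≤ P * (M * (ℓ / 2)) := mul_le_mul_of_nonneg_left hAM hP0.le
    have h3 : (1 + γ) * (P * (M * (ℓ / 2))) = 2 * S := by rw [← hPS, hQ]; ring
    have h4 : γ / (1 + γ) ≤ 1 := by rw [div_le_one hg1]; linarith
    have h6 : P * (M * (ℓ / 2)) ≤ 2 * S := by
      rw [← h3]; nlinarith [mul_pos hP0 (mul_pos hM hℓ)]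
    have h5 : γ / (1 + γ) * (P * A) ≤ 1 * (P * A) :=
      mul_le_mul_of_nonneg_right h4 (by positivity)
    linarith
  · have hkey : B ≤ k ^ γ * (P * A / (1 + γ)) := by
      refine hB.trans ?_
      have e1 : k ^ γ * (P * A / (1 + γ)) =
          γ ^ γ / (γ + 1) ^ (γ + 1) * (ℓ ^ (-γ) * Q ^ (-γ)) * A ^ (1 + γ) := by
        rw [← hPQ, hk, Real.div_rpow (by positivity) (by positivity),
          Real.mul_rpow hγ.le (by positivity), Real.mul_rpow hg1.le hℓ.le,
          Real.mul_rpow hP0.le hA.le, add_comm γ 1, Real.rpow_neg hℓ.le,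
          Real.rpow_add hg1, Real.rpow_add hP0, Real.rpow_add hA, Real.rpow_one, Real.rpow_one,
          Real.rpow_one]
        field_simp
      rw [e1]
      -- After taking γ-th roots this reads 2 ℓ Q ≤ ℓ² M, that is (1 + γ)/2 ≤ 1; the bound γ < 1 is
      -- used here.
      have e2 : (2 / ℓ ^ 2) ^ γ / M ^ γ ≤ ℓ ^ (-γ) * Q ^ (-γ) := by
        rw [← Real.div_rpow (by positivity) hM.le, ← Real.mul_rpow hℓ.le hQ0.le,
          Real.rpow_neg (by positivity), ← Real.inv_rpow (by positivity)]
        refine Real.rpow_le_rpow (by positivity) ?_ hγ.le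
        rw [div_div, div_le_iff₀ (by positivity), inv_mul_eq_div, le_div_iff₀ (by positivity), hQ]
        have : 0 < ℓ ^ 2 * M := by positivity
        nlinarith
      have e3 : 0 ≤ γ ^ γ / (γ + 1) ^ (γ + 1) * A ^ (1 + γ) := by positivity
      have e4 := mul_le_mul_of_nonneg_left e2 e3
      calc _ = γ ^ γ / (γ + 1) ^ (γ + 1) * A ^ (1 + γ) * ((2 / ℓ ^ 2) ^ γ / M ^ γ) := by ring
        _ ≤ _ := e4
        _ = _ := by ring
    have h1 := mul_le_mul_of_nonneg_left hkey (Real.rpow_nonneg hk0.le (-γ))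
    have h2 : k ^ (-γ) * (k ^ γ * (P * A / (1 + γ))) = P * A / (1 + γ) := by
      rw [← mul_assoc, ← Real.rpow_add hk0]; simp
    rw [h2] at h1
    rw [hkℓ]
    have h3 : γ / (1 + γ) * (P * A) + P * A / (1 + γ) = P * A := by field_simp; ring
    linarith

/-- The p-dependent part of the smallness constant is the reciprocal of the L^(p') norm of δ^(-γ),
up to (2/ℓ²)^γ. After Hölder's inequality no trace of p is left. -/
theorem smallnessConst_mul {γ ℓ r : ℝ} (hγ : 0 < γ) (hℓ : 0 < ℓ) (hr : 0 < r) (hγr : γ * r < 1) :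
    γ ^ γ / (γ + 1) ^ (γ + 1) * ((1 - γ * r) ^ (1 / r) / ℓ ^ (γ + 1 / r)) *
      (2 * (ℓ / 2) ^ (1 - γ * r) / (1 - γ * r)) ^ (1 / r) =
    γ ^ γ / (γ + 1) ^ (γ + 1) * (2 / ℓ ^ 2) ^ γ := by
  have h1 : 0 < 1 - γ * r := by linarith
  have h2 : (2 * (ℓ / 2) ^ (1 - γ * r)) ^ (1 / r) = 2 ^ γ * ℓ ^ (1 / r - γ) := by
    have : 2 * (ℓ / 2) ^ (1 - γ * r) = 2 ^ (γ * r) * ℓ ^ (1 - γ * r) := by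
      rw [Real.div_rpow hℓ.le (by norm_num), Real.rpow_sub (by norm_num : (0 : ℝ) < 2),
        Real.rpow_one]
      have : (0 : ℝ) < 2 ^ (γ * r) := by positivity
      field_simp
    rw [this, Real.mul_rpow (by positivity) (by positivity), ← Real.rpow_mul (by norm_num),
      ← Real.rpow_mul hℓ.le]
    congr 2 <;> field_simp
  rw [Real.div_rpow (by positivity) h1.le, h2, Real.div_rpow (by norm_num) (by positivity),
    mul_assoc]
  congr 1
  have h3 : (0 : ℝ) < (1 - γ * r) ^ (1 / r) := by positivity
  have h4 : (ℓ ^ 2) ^ γ = ℓ ^ (2 * γ) := by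
    rw [← Real.rpow_natCast, ← Real.rpow_mul hℓ.le]; norm_num
  have h5 : ℓ ^ (γ + 1 / r) = ℓ ^ (2 * γ) * ℓ ^ (1 / r - γ) := by
    rw [← Real.rpow_add hℓ]; congr 1; ring
  have h6 : (0 : ℝ) < ℓ ^ (1 / r - γ) := by positivity
  rw [h4, h5]
  field_simp

theorem posPart_nonneg_apply (m : ℝ → ℝ) (t : ℝ) : 0 ≤ m⁺ t := by
  rw [Pi.posPart_apply]; exact posPart_nonneg _

theorem MeasureTheory.MemLp.leftWeight {a b : ℝ} {p : ℝ≥0∞} {n : ℝ → ℝ}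
    (hn : MemLp n p (volOn a b)) : MemLp (leftWeight a n) p (volOn a b) := by
  refine (hn.const_mul (b - a)).mono
    ((by fun_prop : AEStronglyMeasurable (fun t : ℝ => t - a) (volOn a b)).mul hn.1) ?_
  filter_upwards [ae_mem_volOn a b] with t ht
  rw [_root_.leftWeight, norm_mul, norm_mul, Real.norm_of_nonneg (by linarith [ht.1] : 0 ≤ t - a),
    Real.norm_of_nonneg (by linarith [ht.1, ht.2] : 0 ≤ b - a)]
  exact mul_le_mul_of_nonneg_right (by linarith [ht.2]) (norm_nonneg _)

theorem MeasureTheory.MemLp.rightWeight {a b : ℝ} {p : ℝ≥0∞} {n : ℝ → ℝ}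
    (hn : MemLp n p (volOn a b)) : MemLp (rightWeight b n) p (volOn a b) := by
  refine (hn.const_mul (b - a)).mono
    ((by fun_prop : AEStronglyMeasurable (fun t : ℝ => b - t) (volOn a b)).mul hn.1) ?_
  filter_upwards [ae_mem_volOn a b] with t ht
  rw [_root_.rightWeight, norm_mul, norm_mul, Real.norm_of_nonneg (by linarith [ht.2] : 0 ≤ b - t),
    Real.norm_of_nonneg (by linarith [ht.1, ht.2] : 0 ≤ b - a)]
  exact mul_le_mul_of_nonneg_right (by linarith [ht.1]) (norm_nonneg _)

theorem integral_mul_bdryDist_eq {a b : ℝ} (hab : a < b) (g : ℝ → ℝ) :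
    ∫ t in a..b, g t * bdryDist a b t = ∫ t, g t * endDist a b t ∂volOn a b := by
  rw [intervalIntegral_eq_integral_volOn hab]
  refine integral_congr_ae ?_
  filter_upwards [ae_mem_volOn a b] with t ht
  rw [bdryDist_eq_min hab (Ioo_subset_Icc_self ht), endDist]

theorem integrable_mul_endDist {a b : ℝ} {g : ℝ → ℝ} (hg : Integrable g (volOn a b)) :
    Integrable (fun t => g t * endDist a b t) (volOn a b) := by
  refine hg.mul_bdd (c := b - a) (continuous_endDist a b).aestronglyMeasurable ?_
  filter_upwards [ae_mem_volOn a b] with t ht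
  rw [Real.norm_of_nonneg (endDist_pos ht).le]
  linarith [endDist_le (a := a) (b := b) t, ht.1, ht.2]

theorem integral_mul_endDist_le {a b : ℝ} {g : ℝ → ℝ} (hg0 : ∀ t, 0 ≤ g t)
    (hg : Integrable g (volOn a b)) :
    ∫ t, g t * endDist a b t ∂volOn a b ≤ (∫ t, g t ∂volOn a b) * ((b - a) / 2) := by
  rw [← integral_mul_const]
  exact integral_mono (integrable_mul_endDist hg) (hg.mul_const _) fun t =>
    mul_le_mul_of_nonneg_left (endDist_le t) (hg0 t)

theorem ae_eq_zero_of_integral_mul_endDist {a b : ℝ} {g : ℝ → ℝ} (hg0 : ∀ t, 0 ≤ g t)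
    (hg : Integrable g (volOn a b)) (h : ∫ t, g t * endDist a b t ∂volOn a b = 0) :
    g =ᵐ[volOn a b] 0 := by
  have hnn : 0 ≤ᵐ[volOn a b] fun t => g t * endDist a b t := by
    filter_upwards [ae_mem_volOn a b] with t ht
    exact mul_nonneg (hg0 t) (endDist_pos ht).le
  have h1 := (integral_eq_zero_iff_of_nonneg_ae hnn (integrable_mul_endDist hg)).1 h
  filter_upwards [h1, ae_mem_volOn a b] with t h2 ht
  exact (mul_eq_zero.1 h2).resolve_right (endDist_pos ht).ne'

theorem integral_mul_endDist_nonneg {a b : ℝ} {g : ℝ → ℝ} (hg0 : ∀ t, 0 ≤ g t) :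
    0 ≤ ∫ t, g t * endDist a b t ∂volOn a b := by
  refine integral_nonneg_of_ae ?_
  filter_upwards [ae_mem_volOn a b] with t ht
  exact mul_nonneg (hg0 t) (endDist_pos ht).le

/-- Existence under the explicit smallness condition. -/
theorem exists_solution_of_smallness {a b : ℝ} (hab : a < b) {m : ℝ → ℝ}
    (hm : MemLp m 2 (volOn a b)) (hm0 : ¬ m =ᵐ[volOn a b] 0) {p : ℝ≥0∞} {γ : ℝ} (hp : 2 ≤ p)
    (hmp : MemLp m⁻ p (volOn a b)) (hγ : 0 < γ) (hγp : γ < 1 - (p⁻¹).toReal)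
    (hsmall : max (lpNormOn a b p (leftWeight a m⁻)) (lpNormOn a b p (rightWeight b m⁻)) ≤
      smallnessConst γ p a b *
        ((∫ t in a..b, m⁺ t * bdryDist a b t) ^ (1 + γ) / (∫ t in a..b, m⁺ t) ^ γ)) :
    ∃ u : ℝ → ℝ, IsSingularSolution a b m γ u ∧
      ContDiffOn ℝ 1 u (Ioo a b) ∧ ContinuousOn u (Icc a b) ∧
      ∀ r : ℝ≥0∞, 1 < r →
        MemLp (fun x => m⁺ x * bdryDist a b x ^ (-γ)) r (volOn a b) →
        (∃ q : ℝ≥0∞, 1 < q ∧ q < ⊤ ∧ MemW2 a b q u) ∧ MemConeInterior a b u := by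
  have hba : 0 < b - a := by linarith
  have hγ1 : γ < 1 := by linarith [ENNReal.toReal_nonneg (a := p⁻¹)]
  have hmi : Integrable m (volOn a b) := hm.integrable (by norm_num)
  have hpi : Integrable m⁺ (volOn a b) := hmi.pos_part
  have hL := hmp.leftWeight
  have hR := hmp.rightWeight
  have hp0 : p ≠ 0 := fun h => by rw [h] at hp; simp at hp
  rw [integral_mul_bdryDist_eq hab, intervalIntegral_eq_integral_volOn hab] at hsmall
  set A := ∫ t, m⁺ t * endDist a b t ∂volOn a b with hA
  set M := ∫ t, m⁺ t ∂volOn a b with hM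
  have hAM : A ≤ M * ((b - a) / 2) := integral_mul_endDist_le (posPart_nonneg_apply m) hpi
  -- If A = 0 then m⁺ = 0 a.e.; the right-hand side of the smallness condition is then 0, which
  -- forces m⁻ = 0 a.e. too, against m ≠ 0.
  have hA0 : 0 < A := by
    refine lt_of_le_of_ne (integral_mul_endDist_nonneg (posPart_nonneg_apply m)) fun h => hm0 ?_
    have hz := ae_eq_zero_of_integral_mul_endDist (posPart_nonneg_apply m) hpi h.symm
    rw [← h, Real.zero_rpow (by linarith), zero_div, mul_zero] at hsmall
    have hl := (le_max_left _ _).trans hsmall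
    have h1 : eLpNorm (leftWeight a m⁻) p (volOn a b) = 0 := by
      have := le_antisymm hl ENNReal.toReal_nonneg
      exact ((ENNReal.toReal_eq_zero_iff _).1 this).resolve_right hL.2.ne
    have h2 := (eLpNorm_eq_zero_iff hL.1 hp0).1 h1
    filter_upwards [hz, h2, ae_mem_volOn a b] with t ht1 ht2 ht
    have h3 : m⁻ t = 0 := (mul_eq_zero.1 ht2).resolve_left (by linarith [ht.1])
    rw [eq_posPart_sub_negPart m t, ht1, h3]
    simp
  obtain ⟨hq0, hqt, hqpos, hqinv⟩ := conjExponent_toReal hp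
  have hH := ENNReal.HolderConjugate.conjExponent (le_trans (by norm_num) hp : 1 ≤ p)
  set r := (ENNReal.conjExponent p).toReal with hr
  have hγr : γ * r < 1 := by rwa [← hqinv, lt_div_iff₀ hqpos] at hγp
  obtain ⟨hLi, hLle⟩ := integral_mul_endDist_rpow_le hab hq0 hqt hγr hL
  obtain ⟨hRi, hRle⟩ := integral_mul_endDist_rpow_le hab hq0 hqt hγr hR
  set D := (2 * ((b - a) / 2) ^ (1 - γ * r) / (1 - γ * r)) ^ (1 / r) with hD
  have hD0 : 0 ≤ D := by
    have : 0 < 1 - γ * r := by linarith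
    positivity
  set B := max (∫ t, leftWeight a m⁻ t * endDist a b t ^ (-γ) ∂volOn a b)
    (∫ t, rightWeight b m⁻ t * endDist a b t ^ (-γ) ∂volOn a b) with hB
  have hBle : B ≤ γ ^ γ / (γ + 1) ^ (γ + 1) * (2 / (b - a) ^ 2) ^ γ *
      (A ^ (1 + γ) / M ^ γ) := by
    have h1 : B ≤ max (lpNormOn a b p (leftWeight a m⁻)) (lpNormOn a b p (rightWeight b m⁻)) * D :=
      max_le (hLle.trans (mul_le_mul_of_nonneg_right (le_max_left _ _) hD0))
        (hRle.trans (mul_le_mul_of_nonneg_right (le_max_right _ _) hD0))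
    refine (h1.trans (mul_le_mul_of_nonneg_right hsmall hD0)).trans (le_of_eq ?_)
    rw [← smallnessConst_mul hγ hba hqpos hγr, smallnessConst]
    ring
  obtain ⟨k, S, hk, hkS, hMS, hkB⟩ := exists_barrier_parameters hγ hγ1 hba hA0 hAM hBle
  obtain ⟨u, huc, hku, hu⟩ := exists_green_solution hab hγ hγ1 hk hkS hmi
    (by rwa [intervalIntegral_eq_integral_volOn hab]) hLi hRi
    (le_trans (add_le_add_right (mul_le_mul_of_nonneg_left (le_max_left _ _)
      (Real.rpow_nonneg hk.le _)) _) hkB)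
    (le_trans (add_le_add_right (mul_le_mul_of_nonneg_left (le_max_right _ _)
      (Real.rpow_nonneg hk.le _)) _) hkB)
  obtain ⟨hsol, hC1, hreg⟩ := green_solution_regularity hab hγ hγ1 hk hmi huc hku hu
  refine ⟨u, hsol, hC1, huc.continuousOn, fun r hr1 hmr => ?_⟩
  obtain ⟨s, hs1, hms⟩ := exists_memLp_mul_endDist_rpow hab hγ hp hγp hmp
  have hmr' : MemLp (fun x => m⁺ x * endDist a b x ^ (-γ)) r (volOn a b) := by
    refine (memLp_congr_ae ?_).1 hmr
    filter_upwards [ae_mem_volOn a b] with t ht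
    rw [bdryDist_eq_min hab (Ioo_subset_Icc_self ht), endDist]
  -- The exponent 2 only serves to keep q finite, since r and s may be infinite.
  set q := min (min r s) 2 with hq
  have hq1 : 1 < q := lt_min (lt_min hr1 hs1) (by norm_num)
  have hmq : MemLp (fun t => m t * endDist a b t ^ (-γ)) q (volOn a b) := by
    have h1 := (hmr'.mono_exponent ((min_le_left _ _).trans (min_le_left _ _) : q ≤ r)).sub
      (hms.mono_exponent ((min_le_left _ _).trans (min_le_right _ _) : q ≤ s))
    refine (memLp_congr_ae (ae_of_all _ fun t => ?_)).1 h1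
    simp only [Pi.sub_apply]
    rw [← sub_mul, ← eq_posPart_sub_negPart]
  obtain ⟨hW, hcone⟩ := hreg q hq1.le hmq
  exact ⟨⟨q, hq1, (min_le_right _ _).trans_lt (by simp), hW⟩, hcone⟩

/-! ### Small exponents, and the main theorem -/

/-- Dominated convergence: for 0 < γ < 1/4 one has δ^(-γ) ≤ 1 + δ^(-1/4), and 1/4 < 1/2 makes W
δ^(-1/4) integrable for W in L². -/
theorem tendsto_integral_mul_endDist_rpow {a b : ℝ} {W : ℝ → ℝ} (hab : a < b)
    (hW : MemLp W 2 (volOn a b)) :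
    Tendsto (fun γ : ℝ => ∫ t, W t * endDist a b t ^ (-γ) ∂volOn a b) (𝓝[>] 0)
      (𝓝 (∫ t, W t ∂volOn a b)) := by
  have h14 : (1 / 4 : ℝ) < 1 - ((2 : ℝ≥0∞)⁻¹).toReal := by
    rw [ENNReal.toReal_inv]; norm_num
  obtain ⟨s, hs, hWs⟩ := exists_memLp_mul_endDist_rpow hab (by norm_num) le_rfl h14 hW
  have hbi : Integrable (fun t => ‖W t‖ + ‖W t * endDist a b t ^ (-(1 / 4) : ℝ)‖) (volOn a b) :=
    (hW.integrable (by norm_num)).norm.add (hWs.integrable hs.le).norm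
  refine tendsto_integral_filter_of_dominated_convergence _
    (Eventually.of_forall fun γ => hW.1.mul (aestronglyMeasurable_endDist_rpow a b _)) ?_ hbi ?_
  · filter_upwards [Ioo_mem_nhdsGT (by norm_num : (0 : ℝ) < 1 / 4)] with γ hγ
    filter_upwards [ae_mem_volOn a b] with t ht
    have hd := endDist_pos ht
    rw [norm_mul, norm_mul, Real.norm_of_nonneg (Real.rpow_nonneg hd.le _),
      Real.norm_of_nonneg (Real.rpow_nonneg hd.le _)]
    have h1 : 0 ≤ endDist a b t ^ (-(1 / 4) : ℝ) := Real.rpow_nonneg hd.le _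
    have h2 : endDist a b t ^ (-γ) ≤ 1 + endDist a b t ^ (-(1 / 4) : ℝ) := by
      rcases le_total 1 (endDist a b t) with h | h
      · have := Real.rpow_le_one_of_one_le_of_nonpos h (by linarith [hγ.1] : -γ ≤ 0)
        linarith
      · have := Real.rpow_le_rpow_of_exponent_ge hd h (by linarith [hγ.2] : -(1 / 4) ≤ -γ)
        linarith
    calc _ ≤ ‖W t‖ * (1 + endDist a b t ^ (-(1 / 4) : ℝ)) :=
          mul_le_mul_of_nonneg_left h2 (norm_nonneg _)
      _ = _ := by ring
  · filter_upwards [ae_mem_volOn a b] with t ht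
    have hd := endDist_pos ht
    have hc : Continuous fun γ : ℝ => W t * endDist a b t ^ (-γ) :=
      continuous_const.mul (continuous_const.rpow continuous_neg fun _ => Or.inl hd.ne')
    have := (hc.tendsto 0).mono_left (nhdsWithin_le_nhds (s := Ioi 0))
    simpa using this

/-- Existence for all small exponents. -/
theorem exists_solution_of_small_exponent {a b : ℝ} (hab : a < b) {m : ℝ → ℝ}
    (hm : MemLp m 2 (volOn a b))
    (h : max (∫ t in a..b, leftWeight a m⁻ t) (∫ t in a..b, rightWeight b m⁻ t) <
      ∫ t in a..b, m⁺ t * bdryDist a b t) :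
    ∃ γ₀ : ℝ, 0 < γ₀ ∧ ∀ γ : ℝ, 0 < γ → γ ≤ γ₀ →
      ∃ u : ℝ → ℝ, IsSingularSolution a b m γ u ∧
        (∃ q : ℝ≥0∞, 1 < q ∧ q < ⊤ ∧ MemW2 a b q u) ∧ MemConeInterior a b u := by
  have hba : 0 < b - a := by linarith
  have hmi : Integrable m (volOn a b) := hm.integrable (by norm_num)
  have hmn : MemLp m⁻ 2 (volOn a b) := hm.neg_part
  have hL := hmn.leftWeight
  have hR := hmn.rightWeight
  rw [integral_mul_bdryDist_eq hab, intervalIntegral_eq_integral_volOn hab,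
    intervalIntegral_eq_integral_volOn hab] at h
  set A := ∫ t, m⁺ t * endDist a b t ∂volOn a b with hA
  set B := max (∫ t, leftWeight a m⁻ t ∂volOn a b) (∫ t, rightWeight b m⁻ t ∂volOn a b) with hB
  set M := ∫ t, m⁺ t ∂volOn a b with hM
  have hM0 : 0 ≤ M := integral_nonneg (posPart_nonneg_apply m)
  -- Half of the gap A - B is spent on k(b - a), so the limiting inequality at γ = 0 stays strict.
  set k := (A - B) / (2 * (b - a)) with hk
  have hk0 : 0 < k := div_pos (by linarith) (by linarith)
  have hkℓ : k * (b - a) = (A - B) / 2 := by rw [hk]; field_simp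
  -- Independent of γ: S ≥ 1 gives S ≤ S^(1+γ), and 1 + γ ≤ 2 turns (b - a)/4 into (b - a)/2.
  set S := max 1 (max ((b - a) / 2 * M) (k * ((b - a) / 2))) with hS
  have hS1 : 1 ≤ S := le_max_left _ _
  have hMS : (b - a) / 2 * M ≤ S := (le_max_left _ _).trans (le_max_right _ _)
  have hkS : k * ((b - a) / 2) ≤ S := (le_max_right _ _).trans (le_max_right _ _)
  have hpow : ∀ c : ℝ, 0 < c → Tendsto (fun γ : ℝ => c ^ (-γ)) (𝓝[>] 0) (𝓝 1) := fun c hc => by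
    have h1 : Continuous fun γ : ℝ => c ^ (-γ) :=
      continuous_const.rpow continuous_neg fun _ => Or.inl hc.ne'
    have := (h1.tendsto 0).mono_left (nhdsWithin_le_nhds (s := Ioi 0))
    simpa using this
  have hev : ∀ W : ℝ → ℝ, MemLp W 2 (volOn a b) → ∫ t, W t ∂volOn a b ≤ B →
      ∀ᶠ γ : ℝ in 𝓝[>] 0,
        k * (b - a) + k ^ (-γ) * ∫ t, W t * endDist a b t ^ (-γ) ∂volOn a b < S ^ (-γ) * A := by
    intro W hW hWB
    have h1 : Tendsto (fun γ : ℝ => k * (b - a) +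
        k ^ (-γ) * ∫ t, W t * endDist a b t ^ (-γ) ∂volOn a b) (𝓝[>] 0)
        (𝓝 (k * (b - a) + 1 * ∫ t, W t ∂volOn a b)) :=
      ((hpow k hk0).mul (tendsto_integral_mul_endDist_rpow hab hW)).const_add _
    have h2 : Tendsto (fun γ : ℝ => S ^ (-γ) * A) (𝓝[>] 0) (𝓝 (1 * A)) :=
      (hpow S (by linarith)).mul_const A
    refine h1.eventually_lt h2 ?_
    rw [hkℓ]
    linarith
  have hall := (hev _ hL (le_max_left _ _)).and ((hev _ hR (le_max_right _ _)).and
    (Ioo_mem_nhdsGT (by norm_num : (0 : ℝ) < 1 / 4)))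
  obtain ⟨γ₀, hγ₀, hsub⟩ := mem_nhdsGT_iff_exists_Ioc_subset.1 hall
  refine ⟨γ₀, hγ₀, fun γ hγ hγle => ?_⟩
  obtain ⟨hl, hr, -, hγ4⟩ := hsub ⟨hγ, hγle⟩
  have hγ1 : γ < 1 := by linarith
  have hγp : γ < 1 - ((2 : ℝ≥0∞)⁻¹).toReal := by
    rw [ENNReal.toReal_inv]; norm_num; linarith
  -- For γ < 1/4 the whole weight m, being in L², has m δ^(-γ) in some L^s with s > 1, so no
  -- separate assumption on m⁺ δ^(-γ) is needed here.
  obtain ⟨s, hs1, hms⟩ := exists_memLp_mul_endDist_rpow hab hγ le_rfl hγp hm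
  obtain ⟨sl, hsl, hLs⟩ := exists_memLp_mul_endDist_rpow hab hγ le_rfl hγp hL
  obtain ⟨sr, hsr, hRs⟩ := exists_memLp_mul_endDist_rpow hab hγ le_rfl hγp hR
  have hMpow : (1 + γ) * ((b - a) / 4 * ∫ t in a..b, m⁺ t) ≤ S ^ (1 + γ) := by
    rw [intervalIntegral_eq_integral_volOn hab]
    have h1 : (1 + γ) * ((b - a) / 4 * M) ≤ 2 * ((b - a) / 4 * M) :=
      mul_le_mul_of_nonneg_right (by linarith) (by positivity)
    have h2 : S ≤ S ^ (1 + γ) := Real.self_le_rpow_of_one_le hS1 (by linarith)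
    linarith
  obtain ⟨u, huc, hku, hu⟩ := exists_green_solution hab hγ hγ1 hk0 hkS hmi hMpow
    (hLs.integrable hsl.le) (hRs.integrable hsr.le) hl.le hr.le
  obtain ⟨hsol, -, hreg⟩ := green_solution_regularity hab hγ hγ1 hk0 hmi huc hku hu
  have hq1 : 1 < min s 2 := lt_min hs1 (by norm_num)
  obtain ⟨hW, hcone⟩ := hreg (min s 2) hq1.le (hms.mono_exponent (min_le_left _ _))
  exact ⟨u, hsol, ⟨min s 2, hq1, (min_le_right _ _).trans_lt (by simp), hW⟩, hcone⟩

theorem mainTheorem5 (a b : ℝ) (hab : a < b) (m : ℝ → ℝ)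
    (hm : MemLp m 2 (volOn a b)) (hm0 : ¬ m =ᵐ[volOn a b] 0) :
    (∀ (p : ℝ≥0∞) (γ : ℝ), 2 ≤ p → MemLp m⁻ p (volOn a b) →
      0 < γ → γ < 1 - (p⁻¹).toReal →
      max (lpNormOn a b p (leftWeight a m⁻)) (lpNormOn a b p (rightWeight b m⁻)) ≤
        smallnessConst γ p a b *
          ((∫ t in a..b, m⁺ t * bdryDist a b t) ^ (1 + γ) / (∫ t in a..b, m⁺ t) ^ γ) →
      ∃ u : ℝ → ℝ, IsSingularSolution a b m γ u ∧
        ContDiffOn ℝ 1 u (Ioo a b) ∧ ContinuousOn u (Icc a b) ∧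
        ∀ r : ℝ≥0∞, 1 < r →
          MemLp (fun x => m⁺ x * bdryDist a b x ^ (-γ)) r (volOn a b) →
          (∃ q : ℝ≥0∞, 1 < q ∧ q < ⊤ ∧ MemW2 a b q u) ∧ MemConeInterior a b u) ∧
    (max (∫ t in a..b, leftWeight a m⁻ t) (∫ t in a..b, rightWeight b m⁻ t) <
        ∫ t in a..b, m⁺ t * bdryDist a b t →
      ∃ γ₀ : ℝ, 0 < γ₀ ∧ ∀ γ : ℝ, 0 < γ → γ ≤ γ₀ →
        ∃ u : ℝ → ℝ, IsSingularSolution a b m γ u ∧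
          (∃ q : ℝ≥0∞, 1 < q ∧ q < ⊤ ∧ MemW2 a b q u) ∧ MemConeInterior a b u) ∧
    (∀ (γ : ℝ) (q : ℝ≥0∞) (u : ℝ → ℝ), 0 < γ → 1 < q →
      IsSingularSolution a b m γ u → MemW2 a b q u →
      ∫ t in a..b, m⁻ t * bdryDist a b t < ∫ t in a..b, m⁺ t * bdryDist a b t) :=
  ⟨fun _ _ hp hmp hγ hγp hsmall => exists_solution_of_smallness hab hm hm0 hp hmp hγ hγp hsmall,
    fun h => exists_solution_of_small_exponent hab hm h,
    fun _ _ _ hγ _ hu _ => hu.integral_negPart_lt hab hm hγ⟩
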